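/- Let $\lambda>0$ and let $$K(\lambda,z)=\frac{\cos \pi z}{\pi}\sum_{n\in\mathbb{Z}}\frac{(-1)^n e^{-\lambda|n-\frac12|}}{z-n+\frac12}\qquad(z\in\mathbb{C}),$$ where the removable singularities at the points $z=n-\frac12$, $n\in\mathbb{Z}$, are filled in by the values $K(\lambda,n-\frac12)=e^{-\lambda|n-\frac12|}$. An entire function $F:\mathbb{C}\to\mathbb{C}$ is said to be of exponential type at most $\sigma\ge 0$ if for every $\varepsilon>0$ there is a constant $C_\varepsilon$ with $|F(z)|\le C_\varepsilon e^{(\sigma+\varepsilon)|z|}$ for all $z\in\mathbb{C}$. Then $z\mapsto K(\lambda,z)$ is an entire function of exponential type at most $\pi$ that interpolates $e^{-\lambda|x|}$ at the points $n-\frac12$, $n\in\mathbb{Z}$, and the following hold. (i) If $\delta>0$ and $\widetilde K$ is an entire function of exponential type at most $\pi\delta$, then $$\int_{-\infty}^{\infty}\left|e^{-\lambda|x|}-\widetilde K(x)\right|\,dx\;\ge\;\frac2\lambda-\frac2\lambda\,\mathrm{sech}\!\left(\frac{\lambda}{2\delta}\right)$$ (the integral may be $+\infty$), with equality if and only if $\widetilde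 K(z)=K(\delta^{-1}\lambda,\delta z)$ for all $z\in\mathbb{C}$. (ii) For every $x\in\mathbb{R}$ the number $K(\lambda,x)$ is real and $$\operatorname{sgn}(\cos \pi x)=\operatorname{sgn}\left\{e^{-\lambda|x|}-K(\lambda,x)\right\},$$ where $\operatorname{sgn}(0)=0$. -/

import Mathlib

/-- `F` is an entire function of exponential type (at most) `σ`: for every `ε > 0` there is a
constant `C` with `|F z| ≤ C e^{(σ + ε)|z|}` for all complex `z`. -/
def IsEntireOfExpType (σ : ℝ) (F : ℂ → ℂ) : Prop :=
  Differentiable ℂ F ∧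
    ∀ ε : ℝ, 0 < ε → ∃ C : ℝ, ∀ z : ℂ, ‖F z‖ ≤ C * Real.exp ((σ + ε) * ‖z‖)

/-- The function
`K(λ, z) = (cos πz / π) ∑_{n ∈ ℤ} (-1)^n e^{-λ|n - 1/2|} / (z - n + 1/2)`.
The formula has removable singularities at the points `z = n - 1/2` with `n` an integer; there the
function takes the value `e^{-λ|n - 1/2|}`, that is `e^{-λ|Re z|}`. -/
noncomputable def expInterp (lam : ℝ) (z : ℂ) : ℂ :=
  open Classical in
  if ∃ n : ℤ, z = (n : ℂ) - 1 / 2 then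
    (Real.exp (-lam * |z.re|) : ℂ)
  else
    Complex.cos (Real.pi * z) / Real.pi *
      ∑' n : ℤ, (-1 : ℂ) ^ n * (Real.exp (-lam * |(n : ℝ) - 1 / 2|) : ℂ) / (z - n + 1 / 2)

/-!
The constant is a duality bound. An integrable function of exponential type `π` has its Fourier
transform supported in frequencies `[-π, π]`, and by continuity the transform vanishes at the end
points; `sgn (cos πx)` only has the frequencies `±π, ±3π, …`. So the two are orthogonal
(`integral_mul_sign_cos_eq_zero`), and for every approximation `F` with integrable error

  `∫ |e^{-λ|x|} - F(x)| dx ≥ ∫ (e^{-λ|x|} - F(x)) sgn (cos πx) dx = ∫ e^{-λ|x|} sgn (cos πx) dx`,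

where the last integral is `(2/λ) (1 - sech (λ/2))`. The case of type `πδ` follows by scaling.

Equality holds for `K` because its error has the sign of `cos πx`: on the real line
`e^{-λ|x|} - K(x) = (cos πx / π) ∫₀^∞ e^{-s|x|} (k(λ - s) - k(λ + s)) ds` with
`k(w) = 1 / (2 cosh (w/2))` (`expInterp_ofReal`), and the integrand is positive since `k` is even
and decreasing on the half-line. This formula rests on the bilateral Laplace transform
`∫ e^{wx} k(w) dw = π / cos πx` for `|x| < 1/2`, an instance of Euler's Beta integral, on the
geometric series of `k`, and on an induction in steps `x ↦ x + 1` that reaches all `x ≥ 0`. It also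
gives the decay `O(1/x²)` of the error, hence the integrability of `K`.

Conversely, equality forces the error of `F` to be aligned with `sgn (cos πx)`, so by continuity it
vanishes at the sign changes `n - 1/2`. Then `F - K` is an integrable function of type `π` that
vanishes at these points, and it is zero because these values are the Fourier coefficients of
(a unimodular multiple of) its Fourier transform on `[-1/2, 1/2]`
(`eq_zero_of_vanish_at_half_integers`).

The support of the Fourier transform is obtained by a contour shift (`integral_mul_exp_eq_zero`). It
needs a bound `|F(z)| ≤ M e^{τ |Im z|}`, which the Phragmén–Lindelöf principle gives for a primitive
of `F`, since integrability of `F` makes the primitive bounded on the real line.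
-/

open MeasureTheory Filter Topology Set FourierTransform

/-! ### The Paley–Wiener support theorem -/

/-- The right half-plane version of Phragmén–Lindelöf, applied to `w ↦ P (iw) e^{-Bw}`. -/
lemma norm_le_exp_im_of_bounded_on_real_upper {P : ℂ → ℂ} {C B M : ℝ} (hP : Differentiable ℂ P)
    (hgrowth : ∀ z, ‖P z‖ ≤ C * Real.exp (B * ‖z‖)) (hreal : ∀ x : ℝ, ‖P x‖ ≤ M)
    {z : ℂ} (hz : 0 ≤ z.im) : ‖P z‖ ≤ M * Real.exp (B * z.im) := by
  have hC : 0 ≤ C := by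
    have h := (norm_nonneg _).trans (hgrowth 0)
    simpa using h
  set f : ℂ → ℂ := fun w => P (Complex.I * w) * Complex.exp (-B * w) with hf
  have hfd : Differentiable ℂ f := by
    have h1 : Differentiable ℂ fun w : ℂ => P (Complex.I * w) :=
      hP.comp (differentiable_id.const_mul _)
    exact h1.mul (by fun_prop)
  have hfn : ∀ w : ℂ, ‖f w‖ = ‖P (Complex.I * w)‖ * Real.exp (-B * w.re) := fun w => by
    simp [hf, Complex.norm_exp]
  have key : ∀ w : ℂ, 0 ≤ w.re → ‖f w‖ ≤ M := by
    intro w hw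
    refine PhragmenLindelof.right_half_plane_of_bounded_on_real hfd.diffContOnCl
      ⟨1, by norm_num, |B| + |B|, ?_⟩ ?_ ?_ hw
    · refine Asymptotics.IsBigO.of_bound C (Eventually.of_forall fun w => ?_)
      rw [hfn, Real.rpow_one, Real.norm_eq_abs, Real.abs_exp]
      calc ‖P (Complex.I * w)‖ * Real.exp (-B * w.re)
          ≤ (C * Real.exp (B * ‖w‖)) * Real.exp (-B * w.re) := by
            gcongr
            simpa using hgrowth (Complex.I * w)
        _ = C * Real.exp (B * ‖w‖ + -B * w.re) := by rw [Real.exp_add]; ring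
        _ ≤ C * Real.exp ((|B| + |B|) * ‖w‖) := by
            gcongr
            rw [add_mul]
            refine add_le_add (mul_le_mul_of_nonneg_right (le_abs_self B) (norm_nonneg w)) ?_
            calc -B * w.re ≤ |-B * w.re| := le_abs_self _
              _ = |B| * |w.re| := by rw [abs_mul, abs_neg]
              _ ≤ |B| * ‖w‖ := by gcongr; exact Complex.abs_re_le_norm w
    · refine ⟨C, ?_⟩
      simp only [eventually_map]
      filter_upwards [eventually_ge_atTop 0] with x hx
      rw [hfn]
      calc ‖P (Complex.I * x)‖ * Real.exp (-B * (x : ℂ).re)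
          ≤ (C * Real.exp (B * x)) * Real.exp (-B * x) := by
            rw [Complex.ofReal_re]
            gcongr
            simpa [abs_of_nonneg hx] using hgrowth (Complex.I * x)
        _ = C := by rw [mul_assoc, ← Real.exp_add]; simp
    · intro x
      rw [hfn]
      have : Complex.I * (x * Complex.I) = ((-x : ℝ) : ℂ) := by
        rw [mul_left_comm, Complex.I_mul_I]; simp
      rw [this]
      simpa using hreal (-x)
  have h := key (-Complex.I * z) (by simpa using hz)
  rw [hfn] at h
  have h1 : Complex.I * (-Complex.I * z) = z := by
    rw [← mul_assoc, mul_neg, Complex.I_mul_I]; simp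
  have h2 : (-Complex.I * z).re = z.im := by simp
  rw [h1, h2, neg_mul, Real.exp_neg] at h
  rwa [← div_eq_mul_inv, div_le_iff₀ (Real.exp_pos _)] at h

/-- An entire function of exponential growth that is bounded by `M` on the real line grows at most
like `M e^{B |Im z|}`: the Phragmén–Lindelöf principle in the upper and lower half-planes. -/
lemma norm_le_exp_im_of_bounded_on_real {P : ℂ → ℂ} {C B M : ℝ} (hP : Differentiable ℂ P)
    (hgrowth : ∀ z, ‖P z‖ ≤ C * Real.exp (B * ‖z‖)) (hreal : ∀ x : ℝ, ‖P x‖ ≤ M) (z : ℂ) :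
    ‖P z‖ ≤ M * Real.exp (B * |z.im|) := by
  rcases le_total 0 z.im with hz | hz
  · rw [abs_of_nonneg hz]
    exact norm_le_exp_im_of_bounded_on_real_upper hP hgrowth hreal hz
  · rw [abs_of_nonpos hz]
    have h := norm_le_exp_im_of_bounded_on_real_upper (P := fun w => P (-w)) (C := C) (B := B)
      (M := M) (hP.comp differentiable_neg) (fun w => by simpa using hgrowth (-w))
      (fun x => by simpa using hreal (-x)) (z := -z) (by simpa using hz)
    simpa using h

/-- An entire function of exponential type `σ` that is integrable on the real line satisfies
`|F z| ≤ M e^{τ |Im z|}` for every `τ > σ`. A primitive of `F` is bounded on the real line by the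
integrability, hence obeys such a bound, and the Cauchy estimate carries it over to `F`. -/
lemma exists_norm_le_exp_im {F : ℂ → ℂ} {σ τ : ℝ} (hF : IsEntireOfExpType σ F) (hστ : σ < τ)
    (hτ : 0 < τ) (hint : Integrable fun x : ℝ => F x) :
    ∃ M : ℝ, ∀ z : ℂ, ‖F z‖ ≤ M * Real.exp (τ * |z.im|) := by
  obtain ⟨hd, hg⟩ := hF
  obtain ⟨P, hP0, hP⟩ := hd.isExactOn_univ.with_val_at 0 0
  replace hP : ∀ z, HasDerivAt P (F z) z := fun z => hP z (mem_univ z)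
  have hPd : Differentiable ℂ P := fun z => (hP z).differentiableAt
  set ρ := max ((σ + τ) / 2) (τ / 2) with hρ
  have hρpos : 0 < ρ := lt_of_lt_of_le (by linarith) (le_max_right _ _)
  have hρτ : ρ < τ := max_lt (by linarith) (by linarith)
  have hσρ : σ < ρ := lt_of_lt_of_le (by linarith) (le_max_left _ _)
  obtain ⟨C, hC⟩ := hg (ρ - σ) (by linarith)
  simp only [add_sub_cancel] at hC
  have hC0 : 0 ≤ C := by
    have h := (norm_nonneg _).trans (hC 0)
    simpa using h
  -- the factor `‖z‖` from integrating `F` along a segment is absorbed by enlarging the type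
  have hgrowth : ∀ z, ‖P z‖ ≤ C / (τ - ρ) * Real.exp (τ * ‖z‖) := by
    intro z
    have h1 : ‖P z - P 0‖ ≤ C * Real.exp (ρ * ‖z‖) * ‖z - 0‖ := by
      refine (convex_closedBall (0 : ℂ) ‖z‖).norm_image_sub_le_of_norm_hasDerivWithin_le
        (f := P) (f' := F) (fun w _ => (hP w).hasDerivWithinAt) (fun w hw => ?_)
        (Metric.mem_closedBall_self (norm_nonneg z)) (by simp)
      refine (hC w).trans ?_
      gcongr
      simpa using hw
    rw [hP0, sub_zero, sub_zero] at h1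
    refine h1.trans ?_
    have h2 : (τ - ρ) * ‖z‖ ≤ Real.exp ((τ - ρ) * ‖z‖) :=
      (by linarith : (τ - ρ) * ‖z‖ ≤ (τ - ρ) * ‖z‖ + 1).trans (Real.add_one_le_exp _)
    have h3 : τ * ‖z‖ = ρ * ‖z‖ + (τ - ρ) * ‖z‖ := by ring
    rw [h3, Real.exp_add, div_mul_eq_mul_div, le_div_iff₀ (by linarith)]
    calc C * Real.exp (ρ * ‖z‖) * ‖z‖ * (τ - ρ)
        = C * (Real.exp (ρ * ‖z‖) * ((τ - ρ) * ‖z‖)) := by ring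
      _ ≤ _ := by gcongr
  have hreal : ∀ x : ℝ, ‖P x‖ ≤ ∫ t : ℝ, ‖F t‖ := by
    intro x
    have h1 : ∫ t in (0 : ℝ)..x, F t = P x - P (0 : ℝ) :=
      intervalIntegral.integral_eq_sub_of_hasDerivAt (f := fun t : ℝ => P t)
        (fun t _ => (hP t).comp_ofReal) hint.intervalIntegrable
    rw [Complex.ofReal_zero, hP0, sub_zero] at h1
    rw [← h1, intervalIntegral.norm_intervalIntegral_eq]
    refine (norm_integral_le_integral_norm _).trans ?_
    exact setIntegral_le_integral hint.norm (Eventually.of_forall fun t => norm_nonneg _)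
  have hPb := norm_le_exp_im_of_bounded_on_real hPd hgrowth hreal
  refine ⟨(∫ t : ℝ, ‖F t‖) * Real.exp τ, fun z => ?_⟩
  have h := Complex.norm_deriv_le_of_forall_mem_sphere_norm_le (c := z) (R := 1)
    (C := (∫ t : ℝ, ‖F t‖) * Real.exp τ * Real.exp (τ * |z.im|)) one_pos hPd.diffContOnCl ?_
  · simpa [(hP z).deriv] using h
  · intro w hw
    refine (hPb w).trans ?_
    rw [mul_assoc, ← Real.exp_add]
    have : 0 ≤ ∫ t : ℝ, ‖F t‖ := integral_nonneg fun t => norm_nonneg _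
    have h1 : |w.im| ≤ 1 + |z.im| := by
      have h2 : |(w - z).im| ≤ 1 := by
        have := Complex.abs_im_le_norm (w - z)
        rw [mem_sphere_iff_norm] at hw
        linarith
      rw [Complex.sub_im] at h2
      have := abs_sub_abs_le_abs_sub w.im z.im
      linarith
    gcongr
    nlinarith

/-- Cauchy's theorem on the rectangles `[-R, R] × [-R, 0]`: the bound by `e^{η Im z}` makes the
integral over the bottom side tend to `0`, and the damping factor `(1 + iεz)⁻²`, whose pole lies in
the upper half-plane, does the same for the vertical sides. -/
lemma integral_damped_eq_zero {H : ℂ → ℂ} {M η ε : ℝ} (hH : Differentiable ℂ H) (hη : 0 < η)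
    (hε : 0 < ε) (hbound : ∀ z : ℂ, z.im ≤ 0 → ‖H z‖ ≤ M * Real.exp (η * z.im))
    (hint : Integrable fun x : ℝ => H x) :
    ∫ x : ℝ, H x / (1 + Complex.I * ε * x) ^ 2 = 0 := by
  have hM : 0 ≤ M := by
    have h := (norm_nonneg _).trans (hbound 0 (by simp))
    simpa using h
  set g : ℂ → ℂ := fun z => H z / (1 + Complex.I * ε * z) ^ 2 with hg
  have hre : ∀ z : ℂ, (1 + Complex.I * ε * z).re = 1 - ε * z.im := fun z => by simp [sub_eq_add_neg]
  have him : ∀ z : ℂ, (1 + Complex.I * ε * z).im = ε * z.re := fun z => by simp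
  have hden1 : ∀ z : ℂ, z.im ≤ 0 → 1 ≤ ‖1 + Complex.I * ε * z‖ := by
    intro z hz
    have h1 := Complex.re_le_norm (1 + Complex.I * ε * z)
    rw [hre] at h1
    nlinarith
  have hden2 : ∀ z : ℂ, ε * |z.re| ≤ ‖1 + Complex.I * ε * z‖ := by
    intro z
    have h1 := Complex.abs_im_le_norm (1 + Complex.I * ε * z)
    rwa [him, abs_mul, abs_of_pos hε] at h1
  have hden0 : ∀ z : ℂ, z.im ≤ 0 → 1 + Complex.I * ε * z ≠ 0 := fun z hz h => by
    have := hden1 z hz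
    rw [h, norm_zero] at this
    linarith
  have hgint : Integrable fun x : ℝ => g x := by
    refine hint.mono ?_ (Eventually.of_forall fun x => ?_)
    · refine Continuous.aestronglyMeasurable ?_
      refine (hH.continuous.comp Complex.continuous_ofReal).div (by fun_prop) fun x => ?_
      exact pow_ne_zero _ (hden0 x (by simp))
    · rw [hg, norm_div, norm_pow]
      exact div_le_self (norm_nonneg _) (one_le_pow₀ (hden1 x (by simp)))
  have hg1 : ∀ z : ℂ, z.im ≤ 0 → ‖g z‖ ≤ M * Real.exp (η * z.im) := by
    intro z hz
    rw [hg, norm_div, norm_pow]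
    exact (div_le_self (norm_nonneg _) (one_le_pow₀ (hden1 z hz))).trans (hbound z hz)
  have hg2 : ∀ z : ℂ, z.im ≤ 0 → 0 < |z.re| → ‖g z‖ ≤ M / (ε * |z.re|) ^ 2 := by
    intro z hz hz'
    rw [hg, norm_div, norm_pow]
    have h1 : ‖H z‖ ≤ M := (hbound z hz).trans
      (mul_le_of_le_one_right hM (Real.exp_le_one_iff.2 (by nlinarith)))
    gcongr
    exact hden2 z
  have hlim := (intervalIntegral_tendsto_integral hgint tendsto_neg_atTop_atBot tendsto_id)
  refine tendsto_nhds_unique hlim ?_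
  refine squeeze_zero_norm' (a := fun R : ℝ => (M * Real.exp (-η * R)) * (2 * R)
    + 2 * (M / ε ^ 2 * R⁻¹)) ?_ ?_
  · filter_upwards [eventually_gt_atTop 0] with R hR
    have hrect := Complex.integral_boundary_rect_eq_zero_of_differentiableOn g
      (⟨-R, -R⟩ : ℂ) (⟨R, 0⟩ : ℂ) ?_
    · simp only [id] at hrect ⊢
      have hside : ∀ a : ℝ, |a| = R → ‖∫ y : ℝ in -R..0, g (a + y * Complex.I)‖
          ≤ M / ε ^ 2 * R⁻¹ := by
        intro a ha
        have h := intervalIntegral.norm_integral_le_of_norm_le_const (a := -R) (b := 0)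
          (f := fun y : ℝ => g (a + y * Complex.I)) (C := M / (ε * R) ^ 2) ?_
        · refine h.trans (le_of_eq ?_)
          rw [zero_sub, neg_neg, abs_of_pos hR]
          field_simp
        · intro y hy
          rw [uIoc_of_le (by linarith)] at hy
          have h2 := hg2 (a + y * Complex.I) (by simpa using hy.2) (by simpa [ha] using hR)
          simpa [ha] using h2
      have hbot : ‖∫ x : ℝ in -R..R, g (x + (-R : ℝ) * Complex.I)‖
          ≤ (M * Real.exp (-η * R)) * (2 * R) := by
        have h := intervalIntegral.norm_integral_le_of_norm_le_const (a := -R) (b := R)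
          (f := fun x : ℝ => g (x + (-R : ℝ) * Complex.I)) (C := M * Real.exp (-η * R)) ?_
        · refine h.trans (le_of_eq ?_)
          rw [sub_neg_eq_add, abs_of_pos (by linarith)]
          ring
        · intro x _
          have h2 := hg1 (x + (-R : ℝ) * Complex.I) (by simp; exact hR.le)
          simpa using h2
      have e : ∫ x : ℝ in -R..R, g x = (∫ x : ℝ in -R..R, g (x + (-R : ℝ) * Complex.I))
          + Complex.I • (∫ y : ℝ in -R..0, g ((R : ℝ) + y * Complex.I))
          - Complex.I • (∫ y : ℝ in -R..0, g ((-R : ℝ) + y * Complex.I)) := by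
        simp only [Complex.ofReal_zero, zero_mul, add_zero] at hrect
        linear_combination -hrect
      rw [e]
      refine (norm_sub_le _ _).trans ?_
      have h1 := norm_add_le (∫ x : ℝ in -R..R, g (x + (-R : ℝ) * Complex.I))
        (Complex.I • (∫ y : ℝ in -R..0, g ((R : ℝ) + y * Complex.I)))
      rw [norm_smul, Complex.norm_I, one_mul] at h1
      rw [norm_smul, Complex.norm_I, one_mul]
      have h2 := hside R (abs_of_pos hR)
      have h3 := hside (-R) (by rw [abs_neg, abs_of_pos hR])
      linarith
    · intro z hz
      have hz' : z.im ≤ 0 := by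
        have h := hz.2
        simp only [mem_preimage] at h
        rw [uIcc_of_le (by linarith)] at h
        exact h.2
      refine DifferentiableAt.differentiableWithinAt ?_
      exact (hH z).div (by fun_prop) (pow_ne_zero _ (hden0 z hz'))
  · have h1 : Tendsto (fun R : ℝ => R * Real.exp (-η * R)) atTop (𝓝 0) := by
      have := tendsto_rpow_mul_exp_neg_mul_atTop_nhds_zero 1 η hη
      simpa using this
    have h2 : Tendsto (fun R : ℝ => R⁻¹) atTop (𝓝 0) := tendsto_inv_atTop_zero
    have h3 := (h1.const_mul (2 * M)).add (h2.const_mul (2 * (M / ε ^ 2)))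
    simp only [mul_zero, add_zero] at h3
    refine h3.congr fun R => ?_
    ring

/-- The damping factor of `integral_damped_eq_zero` is removed by letting `ε` tend to `0`. -/
lemma integral_eq_zero_of_exp_decay {H : ℂ → ℂ} {M η : ℝ} (hH : Differentiable ℂ H) (hη : 0 < η)
    (hbound : ∀ z : ℂ, z.im ≤ 0 → ‖H z‖ ≤ M * Real.exp (η * z.im))
    (hint : Integrable fun x : ℝ => H x) :
    ∫ x : ℝ, H x = 0 := by
  have hne : ∀ (n : ℕ) (x : ℝ), 1 ≤ ‖1 + Complex.I * ((1 / ((n : ℝ) + 1) : ℝ) : ℂ) * x‖ := by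
    intro n x
    have h1 := Complex.re_le_norm (1 + Complex.I * ((1 / ((n : ℝ) + 1) : ℝ) : ℂ) * x)
    have h2 : (1 + Complex.I * ((1 / ((n : ℝ) + 1) : ℝ) : ℂ) * x).re = 1 := by
      simp only [Complex.add_re, Complex.one_re, Complex.mul_re, Complex.mul_im, Complex.I_re,
        Complex.I_im, Complex.ofReal_re, Complex.ofReal_im]
      ring
    linarith
  have hlim : Tendsto (fun n : ℕ => ∫ x : ℝ,
      H x / (1 + Complex.I * ((1 / ((n : ℝ) + 1) : ℝ) : ℂ) * x) ^ 2) atTop (𝓝 (∫ x : ℝ, H x)) := by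
    refine tendsto_integral_of_dominated_convergence (fun x => ‖H x‖) (fun n => ?_) hint.norm
      (fun n => Eventually.of_forall fun x => ?_) (Eventually.of_forall fun x => ?_)
    · refine Continuous.aestronglyMeasurable ?_
      refine (hH.continuous.comp Complex.continuous_ofReal).div (by fun_prop) fun x => ?_
      refine pow_ne_zero _ fun h => ?_
      have := hne n x
      rw [h, norm_zero] at this
      linarith
    · rw [norm_div, norm_pow]
      exact div_le_self (norm_nonneg _) (one_le_pow₀ (hne n x))
    · have h1 : Tendsto (fun n : ℕ => ((1 / ((n : ℝ) + 1) : ℝ) : ℂ)) atTop (𝓝 ((0 : ℝ) : ℂ)) :=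
        (Complex.continuous_ofReal.tendsto 0).comp tendsto_one_div_add_atTop_nhds_zero_nat
      have h2 := (tendsto_const_nhds (x := H x)).div
        (((h1.const_mul Complex.I).mul_const (x : ℂ)).const_add 1 |>.pow 2) (by simp)
      simpa [Pi.div_def] using h2
  refine tendsto_nhds_unique hlim ?_
  refine tendsto_const_nhds.congr fun n => ?_
  exact (integral_damped_eq_zero hH hη (by positivity) hbound hint).symm

/-- **Paley–Wiener**, easy half: the Fourier transform of an integrable function of exponential
type `σ` vanishes at the frequencies beyond `σ`. -/
lemma integral_mul_exp_eq_zero {F : ℂ → ℂ} {σ u : ℝ} (hσ : 0 ≤ σ) (hF : IsEntireOfExpType σ F)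
    (hint : Integrable fun x : ℝ => F x) (hu : σ < |u|) :
    ∫ x : ℝ, F x * Complex.exp (Complex.I * u * x) = 0 := by
  have hint' : ∀ v : ℝ, Integrable fun x : ℝ => F x * Complex.exp (Complex.I * v * x) := by
    intro v
    refine hint.mono ?_ (Eventually.of_forall fun x => ?_)
    · exact ((hF.1.continuous.comp Complex.continuous_ofReal).mul
        (by fun_prop)).aestronglyMeasurable
    · simp [Complex.norm_exp]
  obtain ⟨τ, hτ1, hτ2⟩ := exists_between hu
  obtain ⟨M, hM⟩ := exists_norm_le_exp_im hF hτ1 (hσ.trans_lt hτ1) hint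
  have hnorm : ∀ z : ℂ, ‖Complex.exp (Complex.I * u * z)‖ = Real.exp (-(u * z.im)) := fun z => by
    simp [Complex.norm_exp]
  rcases le_total 0 u with h0 | h0
  · -- for `u > 0` the substitution `x ↦ -x` moves the decay to the lower half-plane
    rw [abs_of_nonneg h0] at hτ2
    have h := integral_eq_zero_of_exp_decay
      (H := fun z => F (-z) * Complex.exp (Complex.I * u * -z)) (M := M) (η := u - τ)
      ((hF.1.comp differentiable_neg).mul (by fun_prop)) (by linarith) (fun z hz => ?_)
      (by simpa using (hint' u).comp_neg)
    · rw [← integral_neg_eq_self]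
      simpa using h
    · rw [norm_mul, hnorm]
      refine (mul_le_mul_of_nonneg_right (hM (-z)) (Real.exp_pos _).le).trans (le_of_eq ?_)
      rw [mul_assoc, ← Real.exp_add, Complex.neg_im, abs_neg, abs_of_nonpos hz]
      ring_nf
  · rw [abs_of_nonpos h0] at hτ2
    refine integral_eq_zero_of_exp_decay (H := fun z => F z * Complex.exp (Complex.I * u * z))
      (M := M) (η := -u - τ) (hF.1.mul (by fun_prop)) (by linarith) (fun z hz => ?_) (hint' u)
    rw [norm_mul, hnorm]
    refine (mul_le_mul_of_nonneg_right (hM z) (Real.exp_pos _).le).trans (le_of_eq ?_)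
    rw [mul_assoc, ← Real.exp_add, abs_of_nonpos hz]
    ring_nf

/-! ### Uniqueness from the values at the half-integers -/

lemma MeasureTheory.Integrable.mul_of_norm_le {f g : ℝ → ℂ} (hf : Integrable f)
    (hg : AEStronglyMeasurable g) {C : ℝ} (hC : ∀ x, ‖g x‖ ≤ C) :
    Integrable fun x => f x * g x :=
  hf.mul_bdd (c := C) hg (Eventually.of_forall hC)

/-- The Fourier transform of an integrable function of exponential type `σ` also vanishes at the
frequencies `±σ`, by continuity. -/
lemma integral_mul_exp_eq_zero_of_le {F : ℂ → ℂ} {σ u : ℝ} (hσ : 0 < σ)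
    (hF : IsEntireOfExpType σ F) (hint : Integrable fun x : ℝ => F x) (hu : σ ≤ |u|) :
    ∫ x : ℝ, F x * Complex.exp (Complex.I * u * x) = 0 := by
  have hcont : Continuous fun v : ℝ => ∫ x : ℝ, F x * Complex.exp (Complex.I * v * x) := by
    refine continuous_of_dominated (bound := fun x : ℝ => ‖F x‖) (fun v => ?_) (fun v => ?_)
      hint.norm (Eventually.of_forall fun x => by fun_prop)
    · exact ((hF.1.continuous.comp Complex.continuous_ofReal).mul
        (by fun_prop)).aestronglyMeasurable
    · exact Eventually.of_forall fun x => by simp [Complex.norm_exp]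
  have hlim : Tendsto (fun n : ℕ => u * (1 + 1 / ((n : ℝ) + 1))) atTop (𝓝 u) := by
    have := (tendsto_one_div_add_atTop_nhds_zero_nat (𝕜 := ℝ)).const_add 1 |>.const_mul u
    simpa using this
  refine tendsto_nhds_unique ((hcont.tendsto u).comp hlim) ?_
  refine tendsto_const_nhds.congr fun n => ?_
  refine (integral_mul_exp_eq_zero hσ.le hF hint ?_).symm
  have hn : 0 < 1 / ((n : ℝ) + 1) := by positivity
  rw [abs_mul, abs_of_pos (by linarith : 0 < 1 + 1 / ((n : ℝ) + 1))]
  nlinarith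

/-- A function of exponential type `π` that is integrable on the real line and vanishes at the
points `n - 1/2` is zero: its Fourier transform is supported in `[-1/2, 1/2]`, and the values at
these points are the Fourier coefficients there of a unimodular multiple of the transform. -/
lemma eq_zero_of_vanish_at_half_integers {G : ℂ → ℂ} (hG : IsEntireOfExpType Real.pi G)
    (hint : Integrable fun x : ℝ => G x) (hzero : ∀ n : ℤ, G ((n : ℂ) - 1 / 2) = 0) (z : ℂ) :
    G z = 0 := by
  set f : ℝ → ℂ := fun x => G x with hf
  have hfc : Continuous f := hG.1.continuous.comp Complex.continuous_ofReal
  have hsupp : ∀ t : ℝ, 1 / 2 ≤ |t| → 𝓕 f t = 0 := by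
    intro t ht
    rw [Real.fourier_real_eq_integral_exp_smul]
    rw [← integral_mul_exp_eq_zero_of_le (u := -2 * Real.pi * t) Real.pi_pos hG hint ?_]
    · refine integral_congr_ae (Eventually.of_forall fun x => ?_)
      simp only [smul_eq_mul, hf]
      rw [mul_comm]
      congr 2
      push_cast
      ring
    · rw [abs_mul, abs_mul, abs_of_pos Real.pi_pos]
      norm_num
      nlinarith [Real.pi_pos]
  have hFc : Continuous (𝓕 f) :=
    VectorFourier.fourierIntegral_continuous Real.continuous_fourierChar (by fun_prop) hint
  have hFint : Integrable (𝓕 f) := by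
    refine hFc.integrable_of_hasCompactSupport ?_
    refine HasCompactSupport.intro (K := Icc (-(1 / 2)) (1 / 2)) isCompact_Icc fun t ht => ?_
    refine hsupp t ?_
    by_contra h
    exact ht (abs_le.1 (not_le.1 h).le)
  have hinv : ∀ x : ℝ, f x = ∫ t in (-1 / 2 : ℝ)..(1 / 2),
      Complex.exp ((2 * Real.pi * (t * x) : ℝ) * Complex.I) * 𝓕 f t := by
    intro x
    rw [← congrFun (hfc.fourierInv_fourier_eq hint hFint) x, Real.fourierInv_eq',
      intervalIntegral.integral_of_le (by norm_num),
      setIntegral_eq_integral_of_forall_compl_eq_zero]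
    · refine integral_congr_ae (Eventually.of_forall fun t => ?_)
      simp [mul_comm]
    · intro t ht
      rw [hsupp t, mul_zero]
      by_contra h
      rw [not_le, abs_lt] at h
      exact ht ⟨by linarith [h.1], h.2.le⟩
  set φ : ℝ → ℂ := fun t => 𝓕 f t * Complex.exp (-(Real.pi * t : ℝ) * Complex.I) with hφ
  have hφc : Continuous φ := hFc.mul (by fun_prop)
  have hab : (-1 / 2 : ℝ) < 1 / 2 := by norm_num
  have hcoef : ∀ n : ℤ, fourierCoeffOn hab φ n = 0 := by
    intro n
    rw [fourierCoeffOn_eq_integral]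
    have h1 : ∫ t in (-1 / 2 : ℝ)..(1 / 2),
        fourier (-n) (t : AddCircle ((1 / 2 : ℝ) - -1 / 2)) • φ t = f ((-n : ℤ) - 1 / 2) := by
      rw [hinv]
      refine intervalIntegral.integral_congr fun t _ => ?_
      simp only [hφ, smul_eq_mul, fourier_coe_apply]
      rw [mul_left_comm, mul_comm, ← Complex.exp_add]
      congr 2
      push_cast
      ring
    have h2 := hzero (-n)
    rw [h1, hf]
    push_cast at h2 ⊢
    rw [h2, smul_zero]
  have hmem : MemLp φ 2 (volume.restrict (Ioc (-1 / 2 : ℝ) (1 / 2))) := by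
    obtain ⟨C, hC⟩ := isCompact_Icc.exists_bound_of_continuousOn
      (hφc.continuousOn (s := Icc (-1 / 2 : ℝ) (1 / 2)))
    refine MemLp.of_bound hφc.aestronglyMeasurable C ?_
    filter_upwards [ae_restrict_mem measurableSet_Ioc] with t ht
    exact hC t (Ioc_subset_Icc_self ht)
  have hpars := tsum_sq_fourierCoeffOn hab hmem
  simp only [hcoef, norm_zero, ne_eq, OfNat.ofNat_ne_zero, not_false_eq_true, zero_pow,
    tsum_zero] at hpars
  have hI : ∫ t in Ioc (-1 / 2 : ℝ) (1 / 2), ‖φ t‖ ^ 2 = 0 := by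
    rw [intervalIntegral.integral_of_le hab.le] at hpars
    norm_num at hpars
    norm_num
    exact hpars.symm
  have hae : (fun t => ‖φ t‖ ^ 2) =ᵐ[volume.restrict (Ioc (-1 / 2 : ℝ) (1 / 2))] 0 := by
    refine (setIntegral_eq_zero_iff_of_nonneg_ae (Eventually.of_forall fun t => by positivity)
      ?_).1 hI
    exact ((hφc.norm.pow 2).integrableOn_Icc (a := (-1 / 2 : ℝ)) (b := 1 / 2)).mono_set
      Ioc_subset_Icc_self
  have hreal : ∀ x : ℝ, G x = 0 := by
    intro x
    change f x = 0
    rw [hinv x, intervalIntegral.integral_of_le hab.le]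
    refine integral_eq_zero_of_ae ?_
    filter_upwards [hae] with t ht
    have h1 : φ t = 0 := by simpa using ht
    have h2 : 𝓕 f t = 0 := by
      simpa [hφ, Complex.exp_ne_zero] using h1
    simp [h2]
  have hGan : AnalyticOnNhd ℂ G univ := hG.1.differentiableOn.analyticOnNhd isOpen_univ
  have h0 : G = fun _ => 0 := by
    refine hGan.eq_of_frequently_eq (z₀ := 0) analyticOnNhd_const ?_
    have hlim : Tendsto (fun n : ℕ => ((1 / ((n : ℝ) + 1) : ℝ) : ℂ)) atTop (𝓝[≠] 0) := by
      refine tendsto_nhdsWithin_iff.2 ⟨?_, Eventually.of_forall fun n => ?_⟩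
      · exact (Complex.continuous_ofReal.tendsto' 0 0 (by simp)).comp
          tendsto_one_div_add_atTop_nhds_zero_nat
      · have : (1 / ((n : ℝ) + 1) : ℝ) ≠ 0 := by positivity
        exact Complex.ofReal_ne_zero.2 this
    exact hlim.frequently (Frequently.of_forall fun n => hreal _)
  exact congrFun h0 z

/-! ### Orthogonality to the sign of the cosine -/

/-- The Newton iteration `q ↦ q (3 - q²) / 2` for the sign function, started at the identity. Its
iterates are odd polynomials mapping `[-1, 1]` to itself and converging there to the sign. -/
noncomputable def signNewton : ℕ → ℝ → ℝ
  | 0, c => c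
  | k + 1, c => signNewton k c * (3 - signNewton k c ^ 2) / 2

lemma signNewton_neg (k : ℕ) (c : ℝ) : signNewton k (-c) = -signNewton k c := by
  induction k with
  | zero => rfl
  | succ k ih => simp only [signNewton, ih]; ring

lemma signNewton_eq_odd_polynomial (k : ℕ) :
    ∃ r : Polynomial ℝ, ∀ c, signNewton k c = c * r.eval (c ^ 2) := by
  induction k with
  | zero => exact ⟨1, fun c => by simp [signNewton]⟩
  | succ k ih =>
    obtain ⟨r, hr⟩ := ih
    refine ⟨Polynomial.C (1 / 2) * r * (3 - Polynomial.X * r ^ 2), fun c => ?_⟩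
    simp only [signNewton, hr, Polynomial.eval_mul, Polynomial.eval_C, Polynomial.eval_sub,
      Polynomial.eval_X, Polynomial.eval_pow, Polynomial.eval_ofNat]
    ring

lemma signNewton_bounds {c : ℝ} (hc0 : 0 < c) (hc1 : c ≤ 1) (k : ℕ) :
    c ≤ signNewton k c ∧ signNewton k c ≤ 1 ∧ 1 - signNewton k c ≤ (1 - c / 2) ^ k := by
  induction k with
  | zero => exact ⟨le_rfl, hc1, by simp [signNewton]; linarith⟩
  | succ k ih =>
    obtain ⟨h1, h2, h3⟩ := ih
    simp only [signNewton]
    set q := signNewton k c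
    have hq : 0 < q := by linarith
    refine ⟨?_, ?_, ?_⟩
    · nlinarith [mul_nonneg hq.le (mul_nonneg (by linarith : 0 ≤ 1 - q) (by linarith : 0 ≤ 1 + q))]
    · nlinarith [mul_nonneg (sq_nonneg (1 - q)) (by linarith : 0 ≤ 2 + q)]
    · have e : 1 - q * (3 - q ^ 2) / 2 = (1 - q) * (1 - (q + q ^ 2) / 2) := by ring
      rw [e, pow_succ]
      refine mul_le_mul h3 (by nlinarith) (by nlinarith) ?_
      exact pow_nonneg (by linarith) k

lemma abs_signNewton_le_one {c : ℝ} (hc : |c| ≤ 1) (k : ℕ) : |signNewton k c| ≤ 1 := by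
  have hpos : ∀ d : ℝ, 0 < d → d ≤ 1 → |signNewton k d| ≤ 1 := fun d h0 h1 => by
    obtain ⟨h2, h3, -⟩ := signNewton_bounds h0 h1 k
    exact abs_le.2 ⟨by linarith, h3⟩
  rcases lt_trichotomy c 0 with h | rfl | h
  · rw [← abs_neg, ← signNewton_neg]
    exact hpos _ (by linarith) (by rwa [abs_of_neg h] at hc)
  · obtain ⟨r, hr⟩ := signNewton_eq_odd_polynomial k
    simp [hr]
  · exact hpos _ h (by rwa [abs_of_pos h] at hc)

lemma tendsto_signNewton {c : ℝ} (hc : |c| ≤ 1) :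
    Tendsto (fun k => signNewton k c) atTop (𝓝 (Real.sign c)) := by
  have hpos : ∀ d : ℝ, 0 < d → d ≤ 1 → Tendsto (fun k => signNewton k d) atTop (𝓝 1) := by
    intro d h0 h1
    have hlim : Tendsto (fun k : ℕ => 1 - (1 - d / 2) ^ k) atTop (𝓝 (1 - 0)) :=
      (tendsto_pow_atTop_nhds_zero_of_lt_one (by linarith) (by linarith)).const_sub 1
    rw [sub_zero] at hlim
    refine tendsto_of_tendsto_of_tendsto_of_le_of_le hlim tendsto_const_nhds (fun k => ?_)
      fun k => (signNewton_bounds h0 h1 k).2.1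
    have := (signNewton_bounds h0 h1 k).2.2
    simp only
    linarith
  rcases lt_trichotomy c 0 with h | rfl | h
  · rw [Real.sign_of_neg h]
    have := (hpos (-c) (by linarith) (by rwa [abs_of_neg h] at hc)).neg
    simpa [signNewton_neg] using this
  · refine tendsto_const_nhds.congr fun k => ?_
    obtain ⟨r, hr⟩ := signNewton_eq_odd_polynomial k
    simp [hr]
  · rw [Real.sign_of_pos h]
    exact hpos c h (by rwa [abs_of_pos h] at hc)

/-- Multiplication by `cos πx` moves the frequency `mπ` to `(m ± 1)π`, so by induction only odd
frequencies are involved, where the Fourier transform of `F` vanishes. -/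
lemma integral_mul_cos_pow_mul_exp_eq_zero {F : ℂ → ℂ} (hF : IsEntireOfExpType Real.pi F)
    (hint : Integrable fun x : ℝ => F x) (n : ℕ) :
    ∀ m : ℤ, Odd (n + m) → ∫ x : ℝ, F x * ((Real.cos (Real.pi * x) ^ n : ℝ) *
      Complex.exp (Complex.I * (Real.pi * m : ℝ) * x)) = 0 := by
  have hintg : ∀ (n : ℕ) (m : ℤ), Integrable fun x : ℝ => F x *
      ((Real.cos (Real.pi * x) ^ n : ℝ) * Complex.exp (Complex.I * (Real.pi * m : ℝ) * x)) := by
    intro n m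
    refine hint.mul_of_norm_le
      (g := fun x : ℝ => (Real.cos (Real.pi * x) ^ n : ℝ) *
        Complex.exp (Complex.I * (Real.pi * m : ℝ) * x))
      (C := 1) (Continuous.aestronglyMeasurable (by fun_prop)) fun x => ?_
    rw [norm_mul, Complex.norm_real, norm_pow, Real.norm_eq_abs]
    have h1 : ‖Complex.exp (Complex.I * (Real.pi * m : ℝ) * x)‖ = 1 := by
      simp [Complex.norm_exp]
    rw [h1, mul_one]
    exact pow_le_one₀ (abs_nonneg _) (Real.abs_cos_le_one _)
  induction n with
  | zero =>
    intro m hm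
    have h := integral_mul_exp_eq_zero_of_le (u := Real.pi * m) Real.pi_pos hF hint ?_
    · simpa using h
    · have hm0 : m ≠ 0 := by rintro rfl; simp at hm
      have h1 : (1 : ℝ) ≤ |(m : ℝ)| := by exact_mod_cast Int.one_le_abs hm0
      rw [abs_mul, abs_of_pos Real.pi_pos]
      nlinarith [Real.pi_pos]
  | succ n ih =>
    intro m hm
    have h1 := ih (m + 1) (by push_cast at hm; convert hm using 1; ring)
    have h2 := ih (m - 1) (by
      push_cast at hm
      have h3 : (n : ℤ) + (m - 1) = n + 1 + m - 2 := by ring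
      rw [h3]
      exact hm.sub_even even_two)
    have h3 := integral_add (hintg n (m + 1)) (hintg n (m - 1))
    rw [h1, h2, add_zero] at h3
    have h4 : ∀ x : ℝ, F x * ((Real.cos (Real.pi * x) ^ n : ℝ) *
          Complex.exp (Complex.I * (Real.pi * (m + 1 : ℤ) : ℝ) * x)) +
        F x * ((Real.cos (Real.pi * x) ^ n : ℝ) *
          Complex.exp (Complex.I * (Real.pi * (m - 1 : ℤ) : ℝ) * x)) =
        2 * (F x * ((Real.cos (Real.pi * x) ^ (n + 1) : ℝ) *
          Complex.exp (Complex.I * (Real.pi * m : ℝ) * x))) := by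
      intro x
      have e1 : Complex.exp (Complex.I * (Real.pi * (m + 1 : ℤ) : ℝ) * x) =
          Complex.exp (Complex.I * (Real.pi * m : ℝ) * x) *
            Complex.exp (Real.pi * x * Complex.I) := by
        rw [← Complex.exp_add]; congr 1; push_cast; ring
      have e2 : Complex.exp (Complex.I * (Real.pi * (m - 1 : ℤ) : ℝ) * x) =
          Complex.exp (Complex.I * (Real.pi * m : ℝ) * x) *
            Complex.exp (-(Real.pi * x) * Complex.I) := by
        rw [← Complex.exp_add]; congr 1; push_cast; ring
      have e3 : ((Real.cos (Real.pi * x) : ℝ) : ℂ) =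
          (Complex.exp (Real.pi * x * Complex.I) +
            Complex.exp (-(Real.pi * x) * Complex.I)) / 2 := by
        rw [Complex.ofReal_cos, Complex.cos]; push_cast; ring
      rw [e1, e2, Complex.ofReal_pow, Complex.ofReal_pow, pow_succ, e3]
      ring
    simp_rw [h4] at h3
    rw [integral_const_mul] at h3
    exact (mul_eq_zero.1 h3).resolve_left two_ne_zero

/-- Functions of exponential type `π` in `L¹` are orthogonal to `sgn (cos πx)`, whose frequencies
are the odd multiples of `π`. Odd polynomials in `cos πx` that converge boundedly to the sign avoid
the question in which sense the Fourier series of `sgn (cos πx)` converges. -/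
lemma integral_mul_sign_cos_eq_zero {F : ℂ → ℂ} (hF : IsEntireOfExpType Real.pi F)
    (hint : Integrable fun x : ℝ => F x) :
    ∫ x : ℝ, F x * (Real.sign (Real.cos (Real.pi * x)) : ℝ) = 0 := by
  have hpoly : ∀ r : Polynomial ℝ,
      Integrable (fun x : ℝ => F x *
        ((Real.cos (Real.pi * x) * r.eval (Real.cos (Real.pi * x) ^ 2) : ℝ) : ℂ)) ∧
      ∫ x : ℝ, F x * ((Real.cos (Real.pi * x) * r.eval (Real.cos (Real.pi * x) ^ 2) : ℝ) : ℂ)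
        = 0 := by
    intro r
    induction r using Polynomial.induction_on' with
    | add p q hp hq =>
      have e : ∀ x : ℝ, F x *
          ((Real.cos (Real.pi * x) * (p + q).eval (Real.cos (Real.pi * x) ^ 2) : ℝ) : ℂ) =
          F x * ((Real.cos (Real.pi * x) * p.eval (Real.cos (Real.pi * x) ^ 2) : ℝ) : ℂ) +
          F x * ((Real.cos (Real.pi * x) * q.eval (Real.cos (Real.pi * x) ^ 2) : ℝ) : ℂ) := by
        intro x
        rw [Polynomial.eval_add]
        push_cast
        ring
      simp_rw [e]
      exact ⟨hp.1.add hq.1, by rw [integral_add hp.1 hq.1, hp.2, hq.2, add_zero]⟩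
    | monomial n a =>
      have e : ∀ x : ℝ, F x *
          ((Real.cos (Real.pi * x) * (Polynomial.monomial n a).eval
            (Real.cos (Real.pi * x) ^ 2) : ℝ) : ℂ) =
          a * (F x * ((Real.cos (Real.pi * x) ^ (2 * n + 1) : ℝ) *
            Complex.exp (Complex.I * (Real.pi * (0 : ℤ) : ℝ) * x))) := by
        intro x
        rw [Polynomial.eval_monomial]
        simp
        ring
      simp_rw [e]
      refine ⟨Integrable.const_mul ?_ _, ?_⟩
      · refine hint.mul_of_norm_le
          (g := fun x : ℝ => (Real.cos (Real.pi * x) ^ (2 * n + 1) : ℝ) *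
            Complex.exp (Complex.I * (Real.pi * (0 : ℤ) : ℝ) * x))
          (C := 1) (Continuous.aestronglyMeasurable (by fun_prop)) fun x => ?_
        rw [norm_mul, Complex.norm_real, norm_pow, Real.norm_eq_abs]
        simp only [Int.cast_zero, mul_zero, Complex.ofReal_zero, zero_mul, Complex.exp_zero,
          norm_one, mul_one]
        exact pow_le_one₀ (abs_nonneg _) (Real.abs_cos_le_one _)
      · rw [integral_const_mul, integral_mul_cos_pow_mul_exp_eq_zero hF hint _ 0 (by simp),
          mul_zero]
  have hlim : Tendsto (fun k : ℕ => ∫ x : ℝ, F x * (signNewton k (Real.cos (Real.pi * x)) : ℝ))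
      atTop (𝓝 (∫ x : ℝ, F x * (Real.sign (Real.cos (Real.pi * x)) : ℝ))) := by
    refine tendsto_integral_of_dominated_convergence (fun x : ℝ => ‖F x‖) (fun k => ?_) hint.norm
      (fun k => Eventually.of_forall fun x => ?_) (Eventually.of_forall fun x => ?_)
    · obtain ⟨r, hr⟩ := signNewton_eq_odd_polynomial k
      simp_rw [hr]
      exact (hpoly r).1.aestronglyMeasurable
    · rw [norm_mul, Complex.norm_real, Real.norm_eq_abs]
      exact mul_le_of_le_one_right (norm_nonneg _)
        (abs_signNewton_le_one (Real.abs_cos_le_one _) k)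
    · exact ((Complex.continuous_ofReal.tendsto _).comp
        (tendsto_signNewton (Real.abs_cos_le_one _))).const_mul _
  refine tendsto_nhds_unique hlim (tendsto_const_nhds.congr fun k => ?_)
  obtain ⟨r, hr⟩ := signNewton_eq_odd_polynomial k
  simp_rw [hr]
  exact (hpoly r).2.symm

lemma Real.measurable_sign : Measurable Real.sign :=
  Measurable.ite measurableSet_Iio measurable_const
    (Measurable.ite measurableSet_Ioi measurable_const measurable_const)

lemma Real.abs_sign_le_one (x : ℝ) : |Real.sign x| ≤ 1 := by
  rcases Real.sign_apply_eq x with h | h | h <;> rw [h] <;> norm_num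

lemma integrable_of_even {E : Type*} [NormedAddCommGroup E] {f : ℝ → E} (hf : ∀ x, f (-x) = f x)
    (h : IntegrableOn f (Ioi 0)) : Integrable f := by
  rw [← integrableOn_univ, ← Iic_union_Ioi (a := (0 : ℝ))]
  refine IntegrableOn.union ?_ h
  have hm : MeasurableEmbedding fun x : ℝ => -x := (Homeomorph.neg ℝ).measurableEmbedding
  rw [← Measure.map_neg_eq_self (volume : Measure ℝ), hm.integrableOn_map_iff]
  have e : f ∘ (fun x : ℝ => -x) = f := funext hf
  rw [e, neg_preimage, neg_Iic, neg_zero]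
  exact Iff.mpr integrableOn_Ici_iff_integrableOn_Ioi h

lemma integrable_exp_neg_mul_abs {lam : ℝ} (hlam : 0 < lam) :
    Integrable fun x : ℝ => Real.exp (-lam * |x|) := by
  have h := integrableOn_exp_mul_Ioi (neg_lt_zero.2 hlam) 0
  refine integrable_of_even (fun x => by rw [abs_neg]) (h.congr_fun (fun x hx => ?_)
    measurableSet_Ioi)
  simp only [abs_of_pos (mem_Ioi.1 hx)]

/-- The integral follows from antiperiodicity: shifting by `1` multiplies the half-line integral by
`-e^{-λ}`. -/
lemma integral_exp_neg_mul_abs_mul_sign_cos {lam : ℝ} (hlam : 0 < lam) :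
    ∫ x : ℝ, Real.exp (-lam * |x|) * Real.sign (Real.cos (Real.pi * x)) =
      2 / lam - 2 / lam * (1 / Real.cosh (lam / 2)) := by
  set f : ℝ → ℝ := fun x => Real.exp (-lam * x) * Real.sign (Real.cos (Real.pi * x)) with hf
  have hfi : IntegrableOn f (Ioi 0) := by
    refine (integrableOn_exp_mul_Ioi (neg_lt_zero.2 hlam) 0).mul_bdd (c := 1) ?_
      (Eventually.of_forall fun x => Real.abs_sign_le_one _)
    exact (Real.measurable_sign.comp (by fun_prop)).aestronglyMeasurable
  have h0 : ∫ x : ℝ, Real.exp (-lam * |x|) * Real.sign (Real.cos (Real.pi * x)) =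
      2 * ∫ x in Ioi (0 : ℝ), f x := by
    rw [← integral_comp_abs]
    refine integral_congr_ae (Eventually.of_forall fun x => ?_)
    simp only [hf]
    rcases abs_choice x with h | h
    · rw [h]
    · rw [h, mul_neg Real.pi, Real.cos_neg]
  have h1 : ∫ x in Ioi (1 : ℝ), f x = -Real.exp (-lam) * ∫ x in Ioi (0 : ℝ), f x := by
    have h := (measurePreserving_add_right volume (1 : ℝ)).setIntegral_preimage_emb
      (measurableEmbedding_addRight 1) f (Ioi 1)
    have hpre : (fun x : ℝ => x + 1) ⁻¹' Ioi 1 = Ioi 0 := by ext x; simp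
    rw [hpre] at h
    rw [← h, ← integral_const_mul]
    refine integral_congr_ae (Eventually.of_forall fun x => ?_)
    simp only [hf]
    rw [mul_add Real.pi, mul_one, Real.cos_add_pi, Real.sign_neg, mul_add, mul_one, Real.exp_add]
    ring
  have h2 : (∫ x in (0 : ℝ)..1, f x) + ∫ x in Ioi (1 : ℝ), f x = ∫ x in Ioi (0 : ℝ), f x :=
    intervalIntegral.integral_interval_add_Ioi hfi (hfi.mono_set (Ioi_subset_Ioi zero_le_one))
  have hexp : ∀ a b : ℝ, ∫ x in a..b, Real.exp (-lam * x) =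
      (Real.exp (-lam * a) - Real.exp (-lam * b)) / lam := by
    intro a b
    rw [intervalIntegral.integral_comp_mul_left (fun x => Real.exp x) (neg_ne_zero.2 hlam.ne'),
      integral_exp, smul_eq_mul]
    field_simp
    ring
  have hfint : ∀ a b : ℝ, 0 ≤ a → a ≤ b → IntervalIntegrable f volume a b := fun a b ha hab =>
    (intervalIntegrable_iff_integrableOn_Ioc_of_le hab).2
      (hfi.mono_set fun x hx => lt_of_le_of_lt ha hx.1)
  have h3 : ∫ x in (0 : ℝ)..1, f x =
      (1 - 2 * Real.exp (-lam * (1 / 2)) + Real.exp (-lam)) / lam := by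
    rw [← intervalIntegral.integral_add_adjacent_intervals
      (hfint 0 (1 / 2) le_rfl (by norm_num)) (hfint (1 / 2) 1 (by norm_num) (by norm_num))]
    have e1 : ∫ x in (0 : ℝ)..(1 / 2), f x = ∫ x in (0 : ℝ)..(1 / 2), Real.exp (-lam * x) := by
      refine intervalIntegral.integral_congr_Ioo_of_le (by norm_num) fun x hx => ?_
      simp only [hf]
      rw [Real.sign_of_pos, mul_one]
      refine Real.cos_pos_of_mem_Ioo ⟨?_, ?_⟩ <;> nlinarith [Real.pi_pos, hx.1, hx.2]
    have e2 : ∫ x in (1 / 2 : ℝ)..1, f x = -∫ x in (1 / 2 : ℝ)..1, Real.exp (-lam * x) := by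
      rw [← intervalIntegral.integral_neg]
      refine intervalIntegral.integral_congr_Ioo_of_le (by norm_num) fun x hx => ?_
      simp only [hf]
      rw [Real.sign_of_neg, mul_neg_one]
      refine Real.cos_neg_of_pi_div_two_lt_of_lt ?_ ?_ <;> nlinarith [Real.pi_pos, hx.1, hx.2]
    rw [e1, e2, hexp, hexp]
    simp only [mul_zero, Real.exp_zero, mul_one]
    ring
  rw [h0]
  have h4 : (1 + Real.exp (-lam)) * ∫ x in Ioi (0 : ℝ), f x =
      (1 - 2 * Real.exp (-lam * (1 / 2)) + Real.exp (-lam)) / lam := by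
    rw [← h3]
    linear_combination -h2 + h1
  have hE : Real.exp (-lam) = Real.exp (-lam * (1 / 2)) ^ 2 := by
    rw [← Real.exp_nat_mul]; congr 1; push_cast; ring
  have hE' : Real.exp (lam / 2) = (Real.exp (-lam * (1 / 2)))⁻¹ := by
    rw [← Real.exp_neg]; congr 1; ring
  have hE'' : Real.exp (-(lam / 2)) = Real.exp (-lam * (1 / 2)) := by congr 1; ring
  rw [Real.cosh_eq, hE', hE'']
  rw [hE] at h4
  set E := Real.exp (-lam * (1 / 2))
  have hEpos : 0 < E := Real.exp_pos _
  have h5 : ∫ x in Ioi (0 : ℝ), f x = (1 - 2 * E + E ^ 2) / lam / (1 + E ^ 2) := by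
    rw [eq_div_iff (by positivity), mul_comm]; exact h4
  rw [h5]
  field_simp
  ring

/-! ### The cardinal series of the interpolating function -/

/-- The entire function `sin (πw) / (πw)`, with the value `1` at `w = 0`. -/
noncomputable def sincPi (w : ℂ) : ℂ := dslope Complex.sin 0 (Real.pi * w)

lemma sincPi_of_ne_zero {w : ℂ} (hw : w ≠ 0) :
    sincPi w = Complex.sin (Real.pi * w) / (Real.pi * w) := by
  have hpi : (Real.pi : ℂ) ≠ 0 := Complex.ofReal_ne_zero.2 Real.pi_ne_zero
  rw [sincPi, dslope_of_ne _ (mul_ne_zero hpi hw), slope_def_field]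
  simp

lemma sincPi_zero : sincPi 0 = 1 := by
  rw [sincPi, mul_zero, dslope_same, Complex.deriv_sin, Complex.cos_zero]

lemma sincPi_int {m : ℤ} (hm : m ≠ 0) : sincPi m = 0 := by
  rw [sincPi_of_ne_zero (Int.cast_ne_zero.2 hm), mul_comm, Complex.sin_int_mul_pi, zero_div]

lemma sincPi_neg (w : ℂ) : sincPi (-w) = sincPi w := by
  rcases eq_or_ne w 0 with rfl | hw
  · rw [neg_zero]
  · rw [sincPi_of_ne_zero hw, sincPi_of_ne_zero (neg_ne_zero.2 hw), mul_neg, Complex.sin_neg,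
      neg_div_neg_eq]

lemma differentiable_sincPi : Differentiable ℂ sincPi := by
  have h : Differentiable ℂ (dslope Complex.sin 0) := by
    rw [← differentiableOn_univ, Complex.differentiableOn_dslope univ_mem]
    exact Complex.differentiable_sin.differentiableOn
  exact h.comp (differentiable_id.const_mul _)

lemma norm_cos_le_exp_abs_im (z : ℂ) : ‖Complex.cos z‖ ≤ Real.exp |z.im| := by
  rw [Complex.cos, norm_div, Complex.norm_ofNat, div_le_iff₀ two_pos]
  refine (norm_add_le _ _).trans ?_
  rw [Complex.norm_exp, Complex.norm_exp]
  have h1 : (z * Complex.I).re ≤ |z.im| := by simpa using neg_le_abs z.im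
  have h2 : (-z * Complex.I).re ≤ |z.im| := by simpa using le_abs_self z.im
  have h3 := Real.exp_le_exp.2 h1
  have h4 := Real.exp_le_exp.2 h2
  linarith

lemma norm_sincPi_le (w : ℂ) : ‖sincPi w‖ ≤ Real.exp (Real.pi * |w.im|) := by
  rcases eq_or_ne w 0 with rfl | hw
  · simp [sincPi_zero]
  have hpi : (Real.pi : ℂ) ≠ 0 := Complex.ofReal_ne_zero.2 Real.pi_ne_zero
  have hne : Real.pi * w ≠ 0 := mul_ne_zero hpi hw
  have him : ((Real.pi : ℂ) * w).im = Real.pi * w.im := by simp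
  rw [sincPi_of_ne_zero hw, norm_div, div_le_iff₀ (norm_pos_iff.2 hne)]
  have h := (convex_segment (0 : ℂ) (Real.pi * w)).norm_image_sub_le_of_norm_hasDerivWithin_le
    (f := Complex.sin) (f' := Complex.cos) (C := Real.exp (Real.pi * |w.im|))
    (fun z _ => (Complex.hasDerivAt_sin z).hasDerivWithinAt) (fun z hz => ?_)
    (left_mem_segment ℝ _ _) (right_mem_segment ℝ _ _)
  · simpa using h
  · refine (norm_cos_le_exp_abs_im z).trans (Real.exp_le_exp.2 ?_)
    obtain ⟨t, ht, rfl⟩ := (segment_eq_image ℝ (0 : ℂ) (Real.pi * w)).subset hz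
    have e : ((1 - t) • (0 : ℂ) + t • ((Real.pi : ℂ) * w)).im = t * (Real.pi * w.im) := by simp
    rw [e, abs_mul, abs_mul, abs_of_nonneg ht.1, abs_of_pos Real.pi_pos]
    exact mul_le_of_le_one_left (by positivity) ht.2

lemma summable_exp_neg_mul_abs_sub_half {lam : ℝ} (hlam : 0 < lam) :
    Summable fun n : ℤ => Real.exp (-lam * |(n : ℝ) - 1 / 2|) := by
  have hgeo : Summable fun n : ℕ => Real.exp (-lam * n) := by
    have := Real.summable_exp_nat_mul_iff.2 (neg_lt_zero.2 hlam)
    simpa [mul_comm] using this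
  have hint : Summable fun n : ℤ => Real.exp (-lam * |(n : ℝ)|) := by
    refine Summable.of_nat_of_neg ?_ ?_
    · simpa using hgeo
    · simpa using hgeo
  refine Summable.of_nonneg_of_le (fun n => (Real.exp_pos _).le) (fun n => ?_)
    (hint.mul_left (Real.exp (lam * (1 / 2))))
  rw [← Real.exp_add]
  refine Real.exp_le_exp.2 ?_
  have h1 : |(n : ℝ)| - |(1 / 2 : ℝ)| ≤ |(n : ℝ) - 1 / 2| := abs_sub_abs_le_abs_sub _ _
  rw [abs_of_pos (by norm_num : (0 : ℝ) < 1 / 2)] at h1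
  nlinarith

lemma norm_exp_mul_sincPi_le (lam : ℝ) (n : ℤ) (z : ℂ) :
    ‖(Real.exp (-lam * |(n : ℝ) - 1 / 2|) : ℂ) * sincPi (z - n + 1 / 2)‖ ≤
      Real.exp (-lam * |(n : ℝ) - 1 / 2|) * Real.exp (Real.pi * |z.im|) := by
  rw [norm_mul, Complex.norm_real, Real.norm_eq_abs, Real.abs_exp]
  gcongr
  have h := norm_sincPi_le (z - n + 1 / 2)
  have e : (z - n + 1 / 2).im = z.im := by
    have : (1 / 2 : ℂ) = ((1 / 2 : ℝ) : ℂ) := by norm_num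
    rw [this, Complex.add_im, Complex.sub_im, Complex.ofReal_im, Complex.intCast_im]
    ring
  rwa [e] at h

lemma int_sub_half_re (n : ℤ) : ((n : ℂ) - 1 / 2).re = (n : ℝ) - 1 / 2 := by
  have : (n : ℂ) - 1 / 2 = (((n : ℝ) - 1 / 2 : ℝ) : ℂ) := by push_cast; ring
  rw [this, Complex.ofReal_re]

lemma expInterp_int_sub_half (lam : ℝ) (n : ℤ) :
    expInterp lam ((n : ℂ) - 1 / 2) = (Real.exp (-lam * |(n : ℝ) - 1 / 2|) : ℂ) := by
  rw [expInterp, if_pos ⟨n, rfl⟩, int_sub_half_re]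

/-- The cardinal series of the interpolating function, which has no exceptional points. -/
lemma expInterp_eq_tsum_sincPi (lam : ℝ) (z : ℂ) :
    expInterp lam z =
      ∑' n : ℤ, (Real.exp (-lam * |(n : ℝ) - 1 / 2|) : ℂ) * sincPi (z - n + 1 / 2) := by
  by_cases h : ∃ n : ℤ, z = (n : ℂ) - 1 / 2
  · obtain ⟨m, rfl⟩ := h
    rw [expInterp_int_sub_half, tsum_eq_single m]
    · have e : (m : ℂ) - 1 / 2 - m + 1 / 2 = 0 := by ring
      rw [e, sincPi_zero, mul_one]
    · intro n hn
      have e : (m : ℂ) - 1 / 2 - n + 1 / 2 = ((m - n : ℤ) : ℂ) := by push_cast; ring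
      rw [e, sincPi_int (sub_ne_zero.2 hn.symm), mul_zero]
  · rw [expInterp, if_neg h, ← tsum_mul_left]
    refine tsum_congr fun n => ?_
    have hne : z - n + 1 / 2 ≠ 0 := fun h0 => h ⟨n, by linear_combination h0⟩
    have hpi : (Real.pi : ℂ) ≠ 0 := Complex.ofReal_ne_zero.2 Real.pi_ne_zero
    have hsin : Complex.sin (Real.pi * (z - n + 1 / 2)) = (-1) ^ n * Complex.cos (Real.pi * z) := by
      have hc : Complex.cos (Real.pi * z - n * Real.pi) = (-1) ^ n * Complex.cos (Real.pi * z) := by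
        rw [Complex.cos_antiperiodic.sub_int_mul_eq n, Int.cast_negOnePow ℂ]
      rw [← hc, ← Complex.sin_add_pi_div_two]
      congr 1
      ring
    rw [sincPi_of_ne_zero hne, hsin]
    field_simp

lemma summable_expInterp_terms {lam : ℝ} (hlam : 0 < lam) (z : ℂ) :
    Summable fun n : ℤ =>
      (Real.exp (-lam * |(n : ℝ) - 1 / 2|) : ℂ) * sincPi (z - n + 1 / 2) :=
  Summable.of_norm_bounded ((summable_exp_neg_mul_abs_sub_half hlam).mul_right _)
    fun n => norm_exp_mul_sincPi_le lam n z

lemma isEntireOfExpType_expInterp {lam : ℝ} (hlam : 0 < lam) :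
    IsEntireOfExpType Real.pi (expInterp lam) := by
  have hs := summable_exp_neg_mul_abs_sub_half hlam
  refine ⟨fun z => ?_, fun ε hε => ?_⟩
  · set U : Set ℂ := {w | |w.im| < |z.im| + 1} with hU
    have hUo : IsOpen U := isOpen_lt (Complex.continuous_im.abs) continuous_const
    have hd : DifferentiableOn ℂ (fun w => ∑' n : ℤ,
        (Real.exp (-lam * |(n : ℝ) - 1 / 2|) : ℂ) * sincPi (w - n + 1 / 2)) U := by
      refine Complex.differentiableOn_tsum_of_summable_norm
        (hs.mul_right (Real.exp (Real.pi * (|z.im| + 1)))) (fun n => ?_) hUo fun n w hw => ?_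
      · refine Differentiable.differentiableOn ?_
        exact (differentiable_sincPi.comp (by fun_prop)).const_mul _
      · refine (norm_exp_mul_sincPi_le lam n w).trans ?_
        have : |w.im| ≤ |z.im| + 1 := le_of_lt hw
        gcongr
    have hz : U ∈ 𝓝 z := hUo.mem_nhds (by simp [hU])
    exact (hd.differentiableAt hz).congr_of_eventuallyEq
      (Eventually.of_forall fun w => expInterp_eq_tsum_sincPi lam w)
  · refine ⟨∑' n : ℤ, Real.exp (-lam * |(n : ℝ) - 1 / 2|), fun z => ?_⟩
    rw [expInterp_eq_tsum_sincPi]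
    refine (norm_tsum_le_tsum_norm (summable_expInterp_terms hlam z).norm).trans ?_
    refine (Summable.tsum_le_tsum (fun n => norm_exp_mul_sincPi_le lam n z)
      (summable_expInterp_terms hlam z).norm (hs.mul_right _)).trans ?_
    rw [tsum_mul_right]
    refine mul_le_mul_of_nonneg_left (Real.exp_le_exp.2 ?_)
      (tsum_nonneg fun n => (Real.exp_pos _).le)
    have h1 := Complex.abs_im_le_norm z
    have h2 := norm_nonneg z
    nlinarith [Real.pi_pos]

lemma expInterp_neg (lam : ℝ) (z : ℂ) : expInterp lam (-z) = expInterp lam z := by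
  rw [expInterp_eq_tsum_sincPi, expInterp_eq_tsum_sincPi, ← (Equiv.subLeft (1 : ℤ)).tsum_eq]
  refine tsum_congr fun n => ?_
  rw [Equiv.subLeft_apply, ← sincPi_neg]
  have e1 : |((1 - n : ℤ) : ℝ) - 1 / 2| = |(n : ℝ) - 1 / 2| := by
    rw [← abs_neg]
    congr 1
    push_cast
    ring
  rw [e1]
  congr 2
  push_cast
  ring

/-! ### The interpolation error on the real line -/

/-- Half the hyperbolic secant of `w / 2`, the density `(e^{w/2} + e^{-w/2})⁻¹` whose bilateral
Laplace transform is `π / cos πx`. -/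
noncomputable def halfSech (w : ℝ) : ℝ := (Real.exp (w / 2) + Real.exp (-(w / 2)))⁻¹

lemma halfSech_pos (w : ℝ) : 0 < halfSech w := by unfold halfSech; positivity

lemma halfSech_neg (w : ℝ) : halfSech (-w) = halfSech w := by
  rw [halfSech, halfSech, neg_div, neg_neg, add_comm]

lemma halfSech_eq_cosh (w : ℝ) : halfSech w = (2 * Real.cosh (w / 2))⁻¹ := by
  rw [halfSech, Real.cosh_eq]
  congr 1
  ring

lemma continuous_halfSech : Continuous halfSech := by
  unfold halfSech
  exact Continuous.inv₀ (by fun_prop) fun w => by positivity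

lemma halfSech_le_exp (w : ℝ) : halfSech w ≤ Real.exp (w / 2) := by
  have h := inv_anti₀ (Real.exp_pos (-(w / 2)))
    (le_add_of_nonneg_left (Real.exp_pos (w / 2)).le)
  rwa [← Real.exp_neg, neg_neg] at h

lemma halfSech_le_exp_neg (w : ℝ) : halfSech w ≤ Real.exp (-(w / 2)) := by
  rw [← halfSech_neg, ← neg_div]
  exact halfSech_le_exp (-w)

/-- The functional equation behind the step `x ↦ x + 1`. -/
lemma exp_add_one_mul_halfSech (x w : ℝ) :
    Real.exp (w * (x + 1)) * halfSech w + Real.exp (w * x) * halfSech w =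
      Real.exp ((x + 1 / 2) * w) := by
  have h1 : Real.exp (w * (x + 1)) = Real.exp ((x + 1 / 2) * w) * Real.exp (w / 2) := by
    rw [← Real.exp_add]; congr 1; ring
  have h2 : Real.exp (w * x) = Real.exp ((x + 1 / 2) * w) * Real.exp (-(w / 2)) := by
    rw [← Real.exp_add]; congr 1; ring
  have h3 : 0 < Real.exp (w / 2) + Real.exp (-(w / 2)) := by positivity
  rw [h1, h2, halfSech]
  field_simp

lemma abs_halfSech_sub_le (a b : ℝ) : |halfSech a - halfSech b| ≤ |a - b| := by
  have hd : ∀ w : ℝ, HasDerivAt halfSech (-(Real.exp (w / 2) * (1 / 2) +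
      Real.exp (-(w / 2)) * (-(1 / 2))) / (Real.exp (w / 2) + Real.exp (-(w / 2))) ^ 2) w := by
    intro w
    have h1 : HasDerivAt (fun w : ℝ => w / 2) (1 / 2) w := (hasDerivAt_id w).div_const 2
    have h2 : Real.exp (w / 2) + Real.exp (-(w / 2)) ≠ 0 := by positivity
    exact (h1.exp.add h1.neg.exp).inv h2
  have h := convex_univ.norm_image_sub_le_of_norm_hasDerivWithin_le (f := halfSech) (C := 1)
    (fun w _ => (hd w).hasDerivWithinAt) (fun w _ => ?_) (mem_univ b) (mem_univ a)
  · simpa using h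
  · have hP := Real.exp_pos (w / 2)
    have hN := Real.exp_pos (-(w / 2))
    have hPN : Real.exp (w / 2) * Real.exp (-(w / 2)) = 1 := by
      rw [← Real.exp_add]; simp
    set P := Real.exp (w / 2)
    set N := Real.exp (-(w / 2))
    rw [Real.norm_eq_abs, abs_div, abs_of_pos (by positivity : 0 < (P + N) ^ 2),
      div_le_one (by positivity)]
    rw [abs_le]
    constructor <;> nlinarith [sq_nonneg (P - N), sq_nonneg (P - 1), sq_nonneg (N - 1)]

lemma integrableOn_exp_mul_halfSech_Iic {x : ℝ} (hx : -(1 / 2) < x) (a : ℝ) :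
    IntegrableOn (fun w => Real.exp (w * x) * halfSech w) (Iic a) := by
  have h := integrableOn_exp_mul_Iic (by linarith : 0 < x + 1 / 2) a
  refine Integrable.mono' h ?_ (Eventually.of_forall fun w => ?_)
  · exact Continuous.aestronglyMeasurable (Continuous.mul (by fun_prop) continuous_halfSech)
  · rw [Real.norm_eq_abs, abs_of_pos (mul_pos (Real.exp_pos _) (halfSech_pos w))]
    refine (mul_le_mul_of_nonneg_left (halfSech_le_exp w) (Real.exp_pos _).le).trans (le_of_eq ?_)
    rw [← Real.exp_add]
    congr 1
    ring

lemma integrableOn_exp_mul_halfSech_Ioi {x : ℝ} (hx : x < 1 / 2) (a : ℝ) :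
    IntegrableOn (fun w => Real.exp (w * x) * halfSech w) (Ioi a) := by
  have h := integrableOn_exp_mul_Ioi (by linarith : x - 1 / 2 < 0) a
  refine Integrable.mono' h ?_ (Eventually.of_forall fun w => ?_)
  · exact Continuous.aestronglyMeasurable (Continuous.mul (by fun_prop) continuous_halfSech)
  · rw [Real.norm_eq_abs, abs_of_pos (mul_pos (Real.exp_pos _) (halfSech_pos w))]
    refine (mul_le_mul_of_nonneg_left (halfSech_le_exp_neg w) (Real.exp_pos _).le).trans
      (le_of_eq ?_)
    rw [← Real.exp_add]
    congr 1
    ring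

/-- The bilateral Laplace transform of `halfSech`: Euler's Beta integral `B(1/2 + x, 1/2 - x)` in
the variable `t = 1 / (1 + e^{-w})`, with the reflection formula. -/
lemma integral_exp_mul_halfSech {x : ℝ} (hx1 : -(1 / 2) < x) (hx2 : x < 1 / 2) :
    ∫ w : ℝ, Real.exp (w * x) * halfSech w = Real.pi / Real.cos (Real.pi * x) := by
  have hre1 : 0 < ((1 / 2 + x : ℝ) : ℂ).re := by rw [Complex.ofReal_re]; linarith
  have hre2 : 0 < ((1 / 2 - x : ℝ) : ℂ).re := by rw [Complex.ofReal_re]; linarith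
  have hG := Complex.Gamma_mul_Gamma_eq_betaIntegral hre1 hre2
  have hsum : ((1 / 2 + x : ℝ) : ℂ) + ((1 / 2 - x : ℝ) : ℂ) = 1 := by push_cast; ring
  have hsub : ((1 / 2 - x : ℝ) : ℂ) = 1 - ((1 / 2 + x : ℝ) : ℂ) := by push_cast; ring
  rw [hsum, Complex.Gamma_one, one_mul] at hG
  have hG2 := Complex.Gamma_mul_Gamma_one_sub ((1 / 2 + x : ℝ) : ℂ)
  rw [← hsub, hG] at hG2
  have hsin : Complex.sin (Real.pi * ((1 / 2 + x : ℝ) : ℂ)) = (Real.cos (Real.pi * x) : ℂ) := by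
    rw [← Complex.ofReal_mul, ← Complex.ofReal_sin, ← Real.sin_add_pi_div_two]
    congr 2
    ring
  rw [hsin, Complex.betaIntegral, intervalIntegral.integral_of_le zero_le_one,
    integral_Ioc_eq_integral_Ioo, ← Real.range_sigmoid, ← image_univ,
    integral_image_eq_integral_abs_deriv_smul MeasurableSet.univ
      (fun w _ => (Real.hasDerivAt_sigmoid w).hasDerivWithinAt) Real.sigmoid_injective.injOn,
    Measure.restrict_univ] at hG2
  have hpt : ∀ w : ℝ, |w.sigmoid * (1 - w.sigmoid)| •
      ((w.sigmoid : ℂ) ^ (((1 / 2 + x : ℝ) : ℂ) - 1) *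
        (1 - (w.sigmoid : ℂ)) ^ (((1 / 2 - x : ℝ) : ℂ) - 1)) =
      ((Real.exp (w * x) * halfSech w : ℝ) : ℂ) := by
    intro w
    have hs0 : 0 < w.sigmoid := Real.sigmoid_pos w
    have hs1 : 0 < 1 - w.sigmoid := sub_pos.2 (Real.sigmoid_lt_one w)
    have e1 : (w.sigmoid : ℂ) ^ (((1 / 2 + x : ℝ) : ℂ) - 1) =
        ((w.sigmoid ^ ((1 / 2 + x) - 1) : ℝ) : ℂ) := by
      rw [Complex.ofReal_cpow hs0.le]; push_cast; rfl
    have e2 : (1 - (w.sigmoid : ℂ)) ^ (((1 / 2 - x : ℝ) : ℂ) - 1) =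
        (((1 - w.sigmoid) ^ ((1 / 2 - x) - 1) : ℝ) : ℂ) := by
      rw [Complex.ofReal_cpow hs1.le]; push_cast; rfl
    rw [e1, e2, abs_of_pos (mul_pos hs0 hs1), Complex.real_smul, ← Complex.ofReal_mul,
      ← Complex.ofReal_mul]
    congr 1
    rw [Real.rpow_sub_one hs0.ne', Real.rpow_sub_one hs1.ne']
    have e3 : w.sigmoid = Real.exp (w / 2) * halfSech w := by
      rw [Real.sigmoid_def, halfSech, ← div_eq_mul_inv, eq_div_iff (by positivity), mul_add,
        inv_mul_eq_div, inv_mul_eq_div, ← add_div, div_eq_iff (by positivity), mul_add, mul_one,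
        ← Real.exp_add]
      congr 2
      ring
    have e4 : 1 - w.sigmoid = Real.exp (-(w / 2)) * halfSech w := by
      have h3 : 0 < Real.exp (w / 2) + Real.exp (-(w / 2)) := by positivity
      rw [e3, halfSech]
      field_simp
      ring
    have hk := halfSech_pos w
    have e5 : w.sigmoid ^ (1 / 2 + x) * (1 - w.sigmoid) ^ (1 / 2 - x) =
        Real.exp (w * x) * halfSech w := by
      rw [e4, e3, Real.mul_rpow (Real.exp_pos _).le hk.le, Real.mul_rpow (Real.exp_pos _).le hk.le,
        ← Real.exp_mul, ← Real.exp_mul]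
      have e6 : halfSech w ^ (1 / 2 + x) * halfSech w ^ (1 / 2 - x) = halfSech w := by
        rw [← Real.rpow_add hk]
        have : (1 / 2 + x) + (1 / 2 - x) = 1 := by ring
        rw [this, Real.rpow_one]
      have e7 : Real.exp (w / 2 * (1 / 2 + x)) * Real.exp (-(w / 2) * (1 / 2 - x)) =
          Real.exp (w * x) := by
        rw [← Real.exp_add]; congr 1; ring
      rw [mul_mul_mul_comm, e6, e7]
    rw [← e5]
    field_simp
  simp_rw [hpt] at hG2
  rw [integral_complex_ofReal] at hG2
  exact_mod_cast hG2

/-- Termwise integration of the geometric series of `halfSech` on a half-line. -/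
lemma hasSum_integral_Ioi_exp_mul_halfSech {lam x : ℝ} (hlam : 0 < lam) (hx : x < 1 / 2) :
    HasSum (fun j : ℕ => (-1) ^ j * Real.exp (lam * (x - j - 1 / 2)) / (j + 1 / 2 - x))
      (∫ w in Ioi lam, Real.exp (w * x) * halfSech w) := by
  have hneg : ∀ j : ℕ, x - j - 1 / 2 < 0 := fun j => by
    have : (0 : ℝ) ≤ j := Nat.cast_nonneg j
    linarith
  have hexp : ∀ j : ℕ, IntegrableOn (fun w => Real.exp ((x - j - 1 / 2) * w)) (Ioi lam) :=
    fun j => integrableOn_exp_mul_Ioi (hneg j) lam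
  have hval : ∀ j : ℕ, ∫ w in Ioi lam, Real.exp ((x - j - 1 / 2) * w) =
      Real.exp (lam * (x - j - 1 / 2)) / (j + 1 / 2 - x) := by
    intro j
    rw [integral_exp_mul_Ioi (hneg j), ← neg_div_neg_eq, neg_neg, mul_comm lam]
    congr 1
    ring
  have h := hasSum_integral_of_summable_integral_norm (μ := volume.restrict (Ioi lam))
    (F := fun (j : ℕ) (w : ℝ) => (-1) ^ j * Real.exp ((x - j - 1 / 2) * w))
    (fun j => (hexp j).const_mul _) ?_
  · have e1 : (fun j : ℕ => ∫ w in Ioi lam, (-1) ^ j * Real.exp ((x - j - 1 / 2) * w)) =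
        fun j : ℕ => (-1) ^ j * Real.exp (lam * (x - j - 1 / 2)) / (j + 1 / 2 - x) := by
      funext j
      rw [integral_const_mul, hval, mul_div_assoc]
    have e2 : ∫ w in Ioi lam, ∑' j : ℕ, (-1) ^ j * Real.exp ((x - j - 1 / 2) * w) =
        ∫ w in Ioi lam, Real.exp (w * x) * halfSech w := by
      refine setIntegral_congr_fun measurableSet_Ioi fun w hw => ?_
      have hw0 : 0 < w := hlam.trans hw
      have hq : Real.exp (-w) < 1 := Real.exp_lt_one_iff.2 (by linarith)
      have e3 : ∀ j : ℕ, (-1 : ℝ) ^ j * Real.exp ((x - j - 1 / 2) * w) =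
          Real.exp ((x - 1 / 2) * w) * (-Real.exp (-w)) ^ j := by
        intro j
        rw [neg_pow (Real.exp (-w)), ← Real.exp_nat_mul, mul_left_comm, ← Real.exp_add]
        congr 2
        ring
      simp_rw [e3]
      rw [tsum_mul_left, tsum_geometric_of_abs_lt_one
        (by rwa [abs_neg, abs_of_pos (Real.exp_pos _)]), sub_neg_eq_add, halfSech]
      have e4 : Real.exp (w / 2) + Real.exp (-(w / 2)) =
          Real.exp (w / 2) * (1 + Real.exp (-w)) := by
        rw [mul_add, mul_one, ← Real.exp_add]
        congr 2
        ring
      have e5 : Real.exp (w * x) = Real.exp ((x - 1 / 2) * w) * Real.exp (w / 2) := by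
        rw [← Real.exp_add]
        congr 1
        ring
      have h1 : 0 < 1 + Real.exp (-w) := by positivity
      rw [e4, e5]
      field_simp
    rwa [e1, e2] at h
  · have e1 : ∀ j : ℕ, ∫ w in Ioi lam, ‖(-1) ^ j * Real.exp ((x - j - 1 / 2) * w)‖ =
        Real.exp (lam * (x - j - 1 / 2)) / (j + 1 / 2 - x) := by
      intro j
      rw [← hval]
      refine integral_congr_ae (Eventually.of_forall fun w => ?_)
      simp
    simp_rw [e1]
    have hgeo : Summable fun j : ℕ => Real.exp (j * -lam) :=
      Real.summable_exp_nat_mul_iff.2 (neg_lt_zero.2 hlam)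
    refine Summable.of_nonneg_of_le (fun j => ?_) (fun j => ?_)
      (hgeo.mul_left (Real.exp (lam * (x - 1 / 2)) / (1 / 2 - x)))
    · exact div_nonneg (Real.exp_pos _).le (by linarith [hneg j])
    · have e2 : Real.exp (lam * (x - j - 1 / 2)) =
          Real.exp (lam * (x - 1 / 2)) * Real.exp (j * -lam) := by
        rw [← Real.exp_add]
        congr 1
        ring
      rw [e2, div_mul_eq_mul_div]
      have : (0 : ℝ) ≤ j := Nat.cast_nonneg j
      have h0 : 0 < 1 / 2 - x := by linarith
      gcongr
      linarith

/-- For `|x - n| < 1/2` the alternating series equals a Laplace integral over `(-∞, λ]` up to the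
term `π / cos πx`. For `n = 0` this is the full Laplace transform minus the tail over `(λ, ∞)`;
each step `x ↦ x + 1` changes the sign of both sides and adds the same exponential to both. -/
lemma hasSum_alternating_exp_div {lam : ℝ} (hlam : 0 < lam) (n : ℕ) :
    ∀ x : ℝ, |x - n| < 1 / 2 →
      HasSum (fun j : ℕ => (-1) ^ j * Real.exp (lam * (x - j - 1 / 2)) / (x - j - 1 / 2))
        ((∫ w in Iic lam, Real.exp (w * x) * halfSech w) -
          Real.pi / Real.cos (Real.pi * x)) := by
  induction n with
  | zero =>
    intro x hx
    rw [Nat.cast_zero, sub_zero, abs_lt] at hx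
    have h1 : (∫ w in Iic lam, Real.exp (w * x) * halfSech w) +
        ∫ w in Ioi lam, Real.exp (w * x) * halfSech w = Real.pi / Real.cos (Real.pi * x) := by
      rw [← integral_exp_mul_halfSech hx.1 hx.2]
      exact intervalIntegral.integral_Iic_add_Ioi (integrableOn_exp_mul_halfSech_Iic hx.1 lam)
        (integrableOn_exp_mul_halfSech_Ioi hx.2 lam)
    have h2 := (hasSum_integral_Ioi_exp_mul_halfSech hlam hx.2).neg
    rw [← h1, sub_add_cancel_left]
    refine h2.congr_fun fun j => ?_
    rw [← div_neg]
    congr 1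
    ring
  | succ n ih =>
    intro x hx
    have hx' : |x - 1 - n| < 1 / 2 := by
      convert hx using 2
      push_cast
      ring
    have hxn : (n : ℝ) + 1 / 2 < x := by
      rw [abs_lt] at hx'
      linarith [hx'.1]
    have hn : (0 : ℝ) ≤ n := Nat.cast_nonneg n
    have h1 := (ih (x - 1) hx').neg
    have h2 : HasSum (fun j : ℕ => (-1) ^ (j + 1) * Real.exp (lam * (x - (j + 1 : ℕ) - 1 / 2)) /
        (x - (j + 1 : ℕ) - 1 / 2)) (-((∫ w in Iic lam, Real.exp (w * (x - 1)) * halfSech w) -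
          Real.pi / Real.cos (Real.pi * (x - 1)))) := by
      refine h1.congr_fun fun j => ?_
      have e : x - ((j + 1 : ℕ) : ℝ) - 1 / 2 = x - 1 - j - 1 / 2 := by push_cast; ring
      rw [e, pow_succ]
      ring
    have h3 := h2.zero_add (f := fun j : ℕ =>
      (-1) ^ j * Real.exp (lam * (x - j - 1 / 2)) / (x - j - 1 / 2))
    convert h3 using 1
    have h4 : (∫ w in Iic lam, Real.exp (w * x) * halfSech w) +
        ∫ w in Iic lam, Real.exp (w * (x - 1)) * halfSech w =
        Real.exp ((x - 1 / 2) * lam) / (x - 1 / 2) := by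
      rw [← integral_exp_mul_Iic (by linarith), ← integral_add
        (integrableOn_exp_mul_halfSech_Iic (by linarith) lam)
        (integrableOn_exp_mul_halfSech_Iic (by linarith) lam)]
      refine integral_congr_ae (Eventually.of_forall fun w => ?_)
      have h5 := exp_add_one_mul_halfSech (x - 1) w
      have e1 : x - 1 + 1 = x := by ring
      have e2 : x - 1 + 1 / 2 = x - 1 / 2 := by ring
      rwa [e1, e2] at h5
    have h6 : Real.cos (Real.pi * (x - 1)) = -Real.cos (Real.pi * x) := by
      rw [← Real.cos_sub_pi]
      congr 1
      ring
    rw [h6, div_neg]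
    simp only [pow_zero, one_mul, Nat.cast_zero, sub_zero]
    rw [mul_comm lam]
    linear_combination h4

/-- The Laplace integral `∫₀^∞ e^{-sx} (halfSech (λ - s) - halfSech (λ + s)) ds`, the factor that
multiplies `cos πx / π` in the interpolation error at `|x|`. -/
noncomputable def errorLaplace (lam x : ℝ) : ℝ :=
  ∫ s in Ioi (0 : ℝ), Real.exp (-s * x) * (halfSech (lam - s) - halfSech (lam + s))

lemma halfSech_diff_pos {lam s : ℝ} (hlam : 0 < lam) (hs : 0 < s) :
    0 < halfSech (lam - s) - halfSech (lam + s) := by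
  rw [sub_pos, halfSech_eq_cosh, halfSech_eq_cosh]
  have h : Real.cosh ((lam - s) / 2) < Real.cosh ((lam + s) / 2) := by
    rw [Real.cosh_lt_cosh, abs_of_pos (by linarith : 0 < (lam + s) / 2), abs_lt]
    constructor <;> linarith
  have := Real.cosh_pos ((lam - s) / 2)
  gcongr

lemma setIntegral_Ioi_exp_halfSech_sub (lam x : ℝ) :
    ∫ s in Ioi (0 : ℝ), Real.exp (-s * x) * halfSech (lam - s) =
      Real.exp (-lam * x) * ∫ w in Iic lam, Real.exp (w * x) * halfSech w := by
  have h := (volume.measurePreserving_sub_left lam).setIntegral_preimage_emb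
    (measurableEmbedding_subLeft lam) (fun w => Real.exp (w * x) * halfSech w) (Iio lam)
  have e : (fun s : ℝ => lam - s) ⁻¹' Iio lam = Ioi 0 := by ext s; simp
  rw [e] at h
  rw [integral_Iic_eq_integral_Iio, ← h, ← integral_const_mul]
  refine integral_congr_ae (Eventually.of_forall fun s => ?_)
  simp only
  rw [← mul_assoc, ← Real.exp_add]
  congr 2
  ring

lemma setIntegral_Ioi_exp_halfSech_add (lam x : ℝ) :
    ∫ s in Ioi (0 : ℝ), Real.exp (-s * x) * halfSech (lam + s) =
      Real.exp (lam * x) * ∫ w in Ioi lam, Real.exp (w * -x) * halfSech w := by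
  have h := (measurePreserving_add_left volume lam).setIntegral_preimage_emb
    (measurableEmbedding_addLeft lam) (fun w => Real.exp (w * -x) * halfSech w) (Ioi lam)
  have e : (fun s : ℝ => lam + s) ⁻¹' Ioi lam = Ioi 0 := by ext s; simp
  rw [e] at h
  rw [← h, ← integral_const_mul]
  refine integral_congr_ae (Eventually.of_forall fun s => ?_)
  simp only
  rw [← mul_assoc, ← Real.exp_add]
  congr 2
  ring

lemma integrableOn_exp_halfSech_sub {x : ℝ} (hx : 0 ≤ x) (lam : ℝ) :
    IntegrableOn (fun s => Real.exp (-s * x) * halfSech (lam - s)) (Ioi 0) := by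
  have h := integrableOn_exp_mul_Ioi (by norm_num : (-(1 / 2) : ℝ) < 0) 0
  refine Integrable.mono' (h.const_mul (Real.exp (lam / 2))) ?_ ?_
  · exact Continuous.aestronglyMeasurable
      (Continuous.mul (by fun_prop) (continuous_halfSech.comp (by fun_prop)))
  · filter_upwards [ae_restrict_mem measurableSet_Ioi] with s hs
    rw [Real.norm_eq_abs, abs_of_pos (mul_pos (Real.exp_pos _) (halfSech_pos _)), ← Real.exp_add]
    have h1 : Real.exp (-s * x) ≤ 1 := Real.exp_le_one_iff.2 (by nlinarith [mem_Ioi.1 hs])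
    refine (mul_le_of_le_one_left (halfSech_pos _).le h1).trans
      ((halfSech_le_exp _).trans (le_of_eq ?_))
    congr 1
    ring

lemma integrableOn_exp_halfSech_add {x : ℝ} (hx : 0 ≤ x) (lam : ℝ) :
    IntegrableOn (fun s => Real.exp (-s * x) * halfSech (lam + s)) (Ioi 0) := by
  have h := integrableOn_exp_halfSech_sub hx (-lam)
  refine h.congr_fun (fun s _ => ?_) measurableSet_Ioi
  simp only
  rw [← halfSech_neg (lam + s)]
  congr 2
  ring

lemma errorLaplace_eq {x : ℝ} (hx : 0 ≤ x) (lam : ℝ) :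
    errorLaplace lam x =
      Real.exp (-lam * x) * (∫ w in Iic lam, Real.exp (w * x) * halfSech w) -
        Real.exp (lam * x) * ∫ w in Ioi lam, Real.exp (w * -x) * halfSech w := by
  rw [errorLaplace, ← setIntegral_Ioi_exp_halfSech_sub, ← setIntegral_Ioi_exp_halfSech_add,
    ← integral_sub (integrableOn_exp_halfSech_sub hx lam) (integrableOn_exp_halfSech_add hx lam)]
  simp_rw [mul_sub]

lemma integrableOn_errorLaplace {x : ℝ} (hx : 0 ≤ x) (lam : ℝ) :
    IntegrableOn (fun s => Real.exp (-s * x) * (halfSech (lam - s) - halfSech (lam + s)))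
      (Ioi 0) := by
  have h := (integrableOn_exp_halfSech_sub hx lam).sub (integrableOn_exp_halfSech_add hx lam)
  refine h.congr_fun (fun s _ => ?_) measurableSet_Ioi
  simp only [Pi.sub_apply]
  ring

lemma errorLaplace_pos {lam x : ℝ} (hlam : 0 < lam) (hx : 0 ≤ x) : 0 < errorLaplace lam x := by
  have hpos : ∀ s ∈ Ioi (0 : ℝ),
      0 < Real.exp (-s * x) * (halfSech (lam - s) - halfSech (lam + s)) :=
    fun s hs => mul_pos (Real.exp_pos _) (halfSech_diff_pos hlam hs)
  rw [errorLaplace, setIntegral_pos_iff_support_of_nonneg_ae _ (integrableOn_errorLaplace hx lam)]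
  · rw [inter_eq_right.2 fun s hs => Function.mem_support.2 (hpos s hs).ne']
    simp
  · filter_upwards [ae_restrict_mem measurableSet_Ioi] with s hs
    exact (hpos s hs).le

lemma errorLaplace_le {lam x : ℝ} (hx : 0 < x) : errorLaplace lam x ≤ 2 / x ^ 2 := by
  have hG := Real.integral_rpow_mul_exp_neg_mul_Ioi (a := 2) (r := x) two_pos hx
  have e : ∀ s : ℝ, s ^ ((2 : ℝ) - 1) * Real.exp (-(x * s)) = s * Real.exp (-(x * s)) := by
    intro s
    norm_num
  simp_rw [e] at hG
  have hI : IntegrableOn (fun s : ℝ => s * Real.exp (-(x * s))) (Ioi 0) := by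
    by_contra h
    rw [integral_undef h, Real.Gamma_two] at hG
    have : 0 < (1 / x) ^ (2 : ℝ) * 1 := by positivity
    linarith
  calc errorLaplace lam x ≤ ∫ s in Ioi (0 : ℝ), 2 * (s * Real.exp (-(x * s))) := by
        refine setIntegral_mono_on (integrableOn_errorLaplace hx.le lam) (hI.const_mul 2)
          measurableSet_Ioi fun s hs => ?_
        have hs0 : 0 < s := hs
        have h1 := (le_abs_self _).trans (abs_halfSech_sub_le (lam - s) (lam + s))
        have h2 : |lam - s - (lam + s)| = 2 * s := by
          rw [show lam - s - (lam + s) = -(2 * s) by ring, abs_neg, abs_of_pos (by linarith)]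
        rw [h2] at h1
        refine (mul_le_mul_of_nonneg_left h1 (Real.exp_pos _).le).trans (le_of_eq ?_)
        rw [show -s * x = -(x * s) by ring]
        ring
    _ = 2 / x ^ 2 := by
        rw [integral_const_mul, hG, Real.Gamma_two, Real.rpow_two]
        field_simp

lemma cos_pi_mul_eq_zero_iff (x : ℝ) : Real.cos (Real.pi * x) = 0 ↔ ∃ n : ℤ, x = n - 1 / 2 := by
  rw [Real.cos_eq_zero_iff]
  constructor
  · rintro ⟨k, hk⟩
    refine ⟨k + 1, mul_left_cancel₀ Real.pi_ne_zero ?_⟩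
    rw [hk]
    push_cast
    ring
  · rintro ⟨n, rfl⟩
    refine ⟨n - 1, ?_⟩
    push_cast
    ring

/-- The partial fraction series of `π K(x) / cos πx`, summed over the nodes on either side of the
origin. -/
lemma hasSum_expInterp_series {lam x : ℝ} (hlam : 0 < lam) (hx : 0 ≤ x)
    (hcos : Real.cos (Real.pi * x) ≠ 0) :
    HasSum (fun n : ℤ => (-1 : ℝ) ^ n * Real.exp (-lam * |(n : ℝ) - 1 / 2|) / (x - n + 1 / 2))
      (Real.exp (-lam * x) * (Real.pi / Real.cos (Real.pi * x)) - errorLaplace lam x) := by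
  obtain ⟨n, hn⟩ : ∃ n : ℕ, |x - n| < 1 / 2 := by
    have h1 := abs_sub_round x
    have h2 : |x - round x| ≠ 1 / 2 := by
      intro h
      rcases abs_choice (x - round x) with h3 | h3
      · exact hcos ((cos_pi_mul_eq_zero_iff x).2 ⟨round x + 1, by push_cast; linarith⟩)
      · exact hcos ((cos_pi_mul_eq_zero_iff x).2 ⟨round x, by linarith⟩)
    have h0 : 0 ≤ round x := by
      have h3 := (abs_le.1 h1).2
      by_contra h4
      have h5 : round x ≤ -1 := by omega
      have h6 : ((round x : ℤ) : ℝ) ≤ -1 := by exact_mod_cast h5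
      linarith
    obtain ⟨m, hm⟩ := Int.eq_ofNat_of_zero_le h0
    refine ⟨m, ?_⟩
    rw [hm, Int.cast_natCast] at h1 h2
    exact lt_of_le_of_ne h1 h2
  -- the nodes to the right of the origin
  have hB := ((hasSum_alternating_exp_div hlam n x hn).mul_left (Real.exp (-lam * x))).neg
  -- the nodes to the left of the origin
  have hA := (hasSum_integral_Ioi_exp_mul_halfSech (x := -x) hlam (by linarith)).mul_left
    (Real.exp (lam * x))
  rw [← (Equiv.addRight (1 : ℤ)).hasSum_iff]
  have h := HasSum.of_nat_of_neg_add_one (f := (fun n : ℤ => (-1 : ℝ) ^ n *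
    Real.exp (-lam * |(n : ℝ) - 1 / 2|) / (x - n + 1 / 2)) ∘ (Equiv.addRight (1 : ℤ)))
    (hB.congr_fun fun j => ?_) (hA.congr_fun fun j => ?_)
  · convert h using 1
    rw [errorLaplace_eq hx]
    ring
  · have hj : (0 : ℝ) ≤ j := Nat.cast_nonneg j
    have e1 : |(((j : ℤ) + 1 : ℤ) : ℝ) - 1 / 2| = j + 1 / 2 := by
      rw [abs_of_pos] <;> push_cast <;> linarith
    have e2 : Real.exp (-lam * x) * Real.exp (lam * (x - j - 1 / 2)) =
        Real.exp (-lam * (j + 1 / 2)) := by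
      rw [← Real.exp_add]; congr 1; ring
    have e3 : x - (((j : ℤ) + 1 : ℤ) : ℝ) + 1 / 2 = x - j - 1 / 2 := by push_cast; ring
    have e4 : (-1 : ℝ) ^ ((j : ℤ) + 1) = -(-1) ^ j := by
      rw [zpow_add_one₀ (by norm_num), zpow_natCast]; ring
    simp only [Function.comp_apply, Equiv.coe_addRight]
    rw [e1, e3, e4, ← e2]
    ring
  · have hj : (0 : ℝ) ≤ j := Nat.cast_nonneg j
    have e0 : -((j : ℤ) + 1) + 1 = -(j : ℤ) := by ring
    have e1 : |((-(j : ℤ) : ℤ) : ℝ) - 1 / 2| = j + 1 / 2 := by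
      rw [abs_of_neg] <;> push_cast <;> linarith
    have e2 : Real.exp (lam * x) * Real.exp (lam * (-x - j - 1 / 2)) =
        Real.exp (-lam * (j + 1 / 2)) := by
      rw [← Real.exp_add]; congr 1; ring
    have e3 : x - ((-(j : ℤ) : ℤ) : ℝ) + 1 / 2 = j + 1 / 2 - -x := by push_cast; ring
    have e4 : (-1 : ℝ) ^ (-(j : ℤ)) = (-1) ^ j := by
      rw [zpow_neg, zpow_natCast, ← inv_pow, inv_neg, inv_one]
    simp only [Function.comp_apply, Equiv.coe_addRight]
    rw [e0, e1, e3, e4, ← e2]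
    ring

lemma expInterp_of_nonneg {lam x : ℝ} (hlam : 0 < lam) (hx : 0 ≤ x) :
    expInterp lam x = ((Real.exp (-lam * x) -
      Real.cos (Real.pi * x) / Real.pi * errorLaplace lam x : ℝ) : ℂ) := by
  by_cases hcos : Real.cos (Real.pi * x) = 0
  · obtain ⟨n, hn⟩ := (cos_pi_mul_eq_zero_iff x).1 hcos
    have e : (x : ℂ) = (n : ℂ) - 1 / 2 := by rw [hn]; push_cast; ring
    rw [hcos, e, expInterp_int_sub_half, ← hn, abs_of_nonneg hx]
    simp
  · have hne : ¬ ∃ n : ℤ, (x : ℂ) = (n : ℂ) - 1 / 2 := by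
      rintro ⟨n, hn⟩
      refine hcos ((cos_pi_mul_eq_zero_iff x).2 ⟨n, ?_⟩)
      have h := congrArg Complex.re hn
      rwa [int_sub_half_re, Complex.ofReal_re] at h
    have hs := Complex.hasSum_ofReal.2 (hasSum_expInterp_series hlam hx hcos)
    have hs' : ∑' n : ℤ, (-1 : ℂ) ^ n * (Real.exp (-lam * |(n : ℝ) - 1 / 2|) : ℂ) /
        ((x : ℂ) - n + 1 / 2) = ((Real.exp (-lam * x) * (Real.pi / Real.cos (Real.pi * x)) -
          errorLaplace lam x : ℝ) : ℂ) := by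
      rw [← hs.tsum_eq]
      refine tsum_congr fun n => ?_
      push_cast
      rfl
    rw [expInterp, if_neg hne, hs', ← Complex.ofReal_mul, ← Complex.ofReal_cos,
      ← Complex.ofReal_div, ← Complex.ofReal_mul]
    congr 1
    have := Real.pi_ne_zero
    field_simp

/-- The interpolation error on the real line. -/
lemma expInterp_ofReal {lam : ℝ} (hlam : 0 < lam) (x : ℝ) :
    expInterp lam x = ((Real.exp (-lam * |x|) -
      Real.cos (Real.pi * x) / Real.pi * errorLaplace lam |x| : ℝ) : ℂ) := by
  rcases le_total 0 x with hx | hx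
  · rw [abs_of_nonneg hx, expInterp_of_nonneg hlam hx]
  · have h := expInterp_of_nonneg hlam (neg_nonneg.2 hx)
    rw [Complex.ofReal_neg, expInterp_neg, mul_neg Real.pi, Real.cos_neg] at h
    rw [abs_of_nonpos hx, h]

lemma sign_cos_eq_sign_error {lam : ℝ} (hlam : 0 < lam) (x : ℝ) :
    Real.sign (Real.cos (Real.pi * x)) =
      Real.sign (Real.exp (-lam * |x|) - (expInterp lam (x : ℂ)).re) := by
  rw [expInterp_ofReal hlam, Complex.ofReal_re, sub_sub_cancel]
  have hH := errorLaplace_pos hlam (abs_nonneg x)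
  have hpi := Real.pi_pos
  rcases lt_trichotomy (Real.cos (Real.pi * x)) 0 with h | h | h
  · rw [Real.sign_of_neg h, Real.sign_of_neg]
    exact mul_neg_of_neg_of_pos (div_neg_of_neg_of_pos h hpi) hH
  · rw [h, zero_div, zero_mul]
  · rw [Real.sign_of_pos h, Real.sign_of_pos]
    positivity

lemma integrable_expInterp {lam : ℝ} (hlam : 0 < lam) :
    Integrable fun x : ℝ => expInterp lam x := by
  have hcont : Continuous fun x : ℝ => expInterp lam x :=
    (isEntireOfExpType_expInterp hlam).1.continuous.comp Complex.continuous_ofReal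
  refine integrable_of_even (fun x => by rw [Complex.ofReal_neg, expInterp_neg]) ?_
  rw [← Ioc_union_Ioi_eq_Ioi zero_le_one]
  refine IntegrableOn.union (hcont.integrableOn_Icc.mono_set Ioc_subset_Icc_self) ?_
  have h1 := integrableOn_exp_mul_Ioi (neg_lt_zero.2 hlam) 1
  have h2 := (integrableOn_Ioi_rpow_of_lt (by norm_num : (-2 : ℝ) < -1) zero_lt_one).const_mul 2
  refine Integrable.mono' (h1.add h2) hcont.aestronglyMeasurable ?_
  filter_upwards [ae_restrict_mem measurableSet_Ioi] with x hx
  have hx0 : 0 < x := zero_lt_one.trans hx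
  have hH := errorLaplace_pos hlam hx0.le
  rw [expInterp_of_nonneg hlam hx0.le, Complex.norm_real, Real.norm_eq_abs, Pi.add_apply]
  refine (abs_sub _ _).trans ?_
  rw [Real.abs_exp, abs_mul, abs_div, abs_of_pos hH, abs_of_pos Real.pi_pos]
  have h3 : |Real.cos (Real.pi * x)| / Real.pi ≤ 1 := by
    rw [div_le_one Real.pi_pos]
    exact (Real.abs_cos_le_one _).trans (by linarith [Real.pi_gt_three])
  have h4 : (2 : ℝ) * x ^ (-2 : ℝ) = 2 / x ^ 2 := by
    rw [Real.rpow_neg hx0.le, Real.rpow_two, div_eq_mul_inv]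
  rw [h4]
  exact add_le_add le_rfl ((mul_le_of_le_one_left hH.le h3).trans (errorLaplace_le hx0))

/-! ### The extremal problem -/

lemma IsEntireOfExpType.sub {σ : ℝ} {F G : ℂ → ℂ} (hF : IsEntireOfExpType σ F)
    (hG : IsEntireOfExpType σ G) : IsEntireOfExpType σ fun z => F z - G z := by
  refine ⟨hF.1.sub hG.1, fun ε hε => ?_⟩
  obtain ⟨C, hC⟩ := hF.2 ε hε
  obtain ⟨D, hD⟩ := hG.2 ε hε
  refine ⟨C + D, fun z => (norm_sub_le _ _).trans ?_⟩
  rw [add_mul]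
  exact add_le_add (hC z) (hD z)

lemma IsEntireOfExpType.comp_inv_mul {δ : ℝ} (hδ : 0 < δ) {F : ℂ → ℂ}
    (hF : IsEntireOfExpType (Real.pi * δ) F) :
    IsEntireOfExpType Real.pi fun z => F (((δ⁻¹ : ℝ) : ℂ) * z) := by
  refine ⟨hF.1.comp (differentiable_id.const_mul _), fun ε hε => ?_⟩
  obtain ⟨C, hC⟩ := hF.2 (ε * δ) (mul_pos hε hδ)
  refine ⟨C, fun z => (hC _).trans (le_of_eq ?_)⟩
  rw [norm_mul, Complex.norm_real, Real.norm_eq_abs, abs_of_pos (inv_pos.2 hδ)]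
  congr 2
  field_simp

lemma integrable_of_integrable_error {lam : ℝ} (hlam : 0 < lam) {F : ℂ → ℂ}
    (hw : Integrable fun x : ℝ => (Real.exp (-lam * |x|) : ℂ) - F x) :
    Integrable fun x : ℝ => F x := by
  have h := (integrable_exp_neg_mul_abs hlam).ofReal (𝕜 := ℂ)
  have h2 := h.sub hw
  refine h2.congr (Eventually.of_forall fun x => ?_)
  simp

/-- The duality behind the lower bound: against `sgn (cos πx)` the error of every approximation has
the same integral. -/
lemma integral_error_mul_sign_cos {lam : ℝ} (hlam : 0 < lam) {F : ℂ → ℂ}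
    (hF : IsEntireOfExpType Real.pi F)
    (hw : Integrable fun x : ℝ => (Real.exp (-lam * |x|) : ℂ) - F x) :
    ∫ x : ℝ, ((Real.exp (-lam * |x|) : ℂ) - F x) * (Real.sign (Real.cos (Real.pi * x)) : ℝ) =
      ((2 / lam - 2 / lam * (1 / Real.cosh (lam / 2)) : ℝ) : ℂ) := by
  have hFi := integrable_of_integrable_error hlam hw
  have hs : AEStronglyMeasurable
      fun x : ℝ => ((Real.sign (Real.cos (Real.pi * x)) : ℝ) : ℂ) :=
    (Complex.measurable_ofReal.comp (Real.measurable_sign.comp (by fun_prop))).aestronglyMeasurable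
  have hs1 : ∀ x : ℝ, ‖((Real.sign (Real.cos (Real.pi * x)) : ℝ) : ℂ)‖ ≤ 1 := fun x => by
    rw [Complex.norm_real]
    exact Real.abs_sign_le_one _
  have h1 : Integrable fun x : ℝ =>
      (Real.exp (-lam * |x|) : ℂ) * (Real.sign (Real.cos (Real.pi * x)) : ℝ) :=
    ((integrable_exp_neg_mul_abs hlam).ofReal (𝕜 := ℂ)).mul_of_norm_le hs hs1
  have h2 := hFi.mul_of_norm_le hs hs1
  simp_rw [sub_mul]
  rw [integral_sub h1 h2, integral_mul_sign_cos_eq_zero hF hFi, sub_zero,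
    ← integral_exp_neg_mul_abs_mul_sign_cos hlam, ← integral_complex_ofReal]
  simp

lemma exists_cos_mul_cos_neg {a : ℝ} (ha : Real.cos a = 0) {t : ℝ} (h0 : 0 < t)
    (h1 : t < Real.pi) : Real.cos (a + t) * Real.cos (a - t) < 0 := by
  have hs : Real.sin a ^ 2 = 1 := by
    have := Real.sin_sq_add_cos_sq a
    rw [ha] at this
    linarith
  have ht := Real.sin_pos_of_pos_of_lt_pi h0 h1
  rw [Real.cos_add, Real.cos_sub, ha]
  nlinarith [mul_pos ht ht]

lemma mem_closure_cos_pos {x : ℝ} (hx : Real.cos (Real.pi * x) = 0) :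
    x ∈ closure {y : ℝ | 0 < Real.cos (Real.pi * y)} ∧
      x ∈ closure {y : ℝ | Real.cos (Real.pi * y) < 0} := by
  have key : ∀ ε : ℝ, 0 < ε → ∃ t : ℝ, |t| < ε ∧ 0 < Real.cos (Real.pi * (x + t)) ∧
      Real.cos (Real.pi * (x - t)) < 0 := by
    intro ε hε
    obtain ⟨t, ht0, ht1⟩ := exists_between (lt_min hε one_pos)
    have h := exists_cos_mul_cos_neg hx (t := Real.pi * t) (mul_pos Real.pi_pos ht0)
      (by nlinarith [Real.pi_pos, min_le_right ε 1])
    rw [← mul_add, ← mul_sub] at h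
    have htε : t < ε := ht1.trans_le (min_le_left _ _)
    rcases mul_neg_iff.1 h with ⟨h1, h2⟩ | ⟨h1, h2⟩
    · exact ⟨t, by rwa [abs_of_pos ht0], h1, h2⟩
    · exact ⟨-t, by rwa [abs_neg, abs_of_pos ht0], by rwa [← sub_eq_add_neg], by
        rwa [sub_neg_eq_add]⟩
  constructor
  · refine Metric.mem_closure_iff.2 fun ε hε => ?_
    obtain ⟨t, ht, h1, -⟩ := key ε hε
    exact ⟨x + t, h1, by rw [dist_comm, Real.dist_eq, add_sub_cancel_left]; exact ht⟩
  · refine Metric.mem_closure_iff.2 fun ε hε => ?_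
    obtain ⟨t, ht, -, h1⟩ := key ε hε
    exact ⟨x - t, h1, by rw [Real.dist_eq, sub_sub_cancel]; exact ht⟩

/-- If the error `w` aligns with `sgn (cos πx)`, in the sense `‖w‖ |cos πx| = Re w · cos πx`, then
it vanishes at the sign changes of the cosine. -/
lemma eq_zero_of_aligned_with_cos {w : ℝ → ℂ} (hw : Continuous w)
    (h : ∀ x, ‖w x‖ * |Real.cos (Real.pi * x)| = (w x).re * Real.cos (Real.pi * x)) {x : ℝ}
    (hx : Real.cos (Real.pi * x) = 0) : w x = 0 := by
  obtain ⟨hp, hn⟩ := mem_closure_cos_pos hx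
  have h1 : ‖w x‖ = (w x).re := by
    have hcl : IsClosed {y : ℝ | ‖w y‖ = (w y).re} :=
      isClosed_eq hw.norm (Complex.continuous_re.comp hw)
    refine closure_minimal (fun y hy => ?_) hcl hp
    have hy0 : 0 < Real.cos (Real.pi * y) := hy
    have := h y
    rw [abs_of_pos hy0] at this
    exact mul_right_cancel₀ hy0.ne' this
  have h2 : ‖w x‖ = -(w x).re := by
    have hcl : IsClosed {y : ℝ | ‖w y‖ = -(w y).re} :=
      isClosed_eq hw.norm (Complex.continuous_re.comp hw).neg
    refine closure_minimal (fun y hy => ?_) hcl hn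
    have hy0 : Real.cos (Real.pi * y) < 0 := hy
    have := h y
    rw [abs_of_neg hy0] at this
    exact mul_right_cancel₀ hy0.ne (by linarith)
  exact norm_eq_zero.1 (by linarith)

lemma Real.sign_mul_abs_self (c : ℝ) : Real.sign c * |c| = c := by
  rcases lt_trichotomy c 0 with h | rfl | h
  · rw [Real.sign_of_neg h, abs_of_neg h]; ring
  · simp
  · rw [Real.sign_of_pos h, abs_of_pos h, one_mul]

/-- An extremal error vanishes at the zeros of `cos πx`. Equality in the duality bound gives
`‖w‖ = Re w · sgn (cos πx)` almost everywhere; multiplied by `|cos πx|` both sides are continuous,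
so they agree everywhere. -/
lemma error_eq_zero_of_integral_norm_eq {lam : ℝ} (hlam : 0 < lam) {F : ℂ → ℂ}
    (hF : IsEntireOfExpType Real.pi F)
    (hw : Integrable fun x : ℝ => (Real.exp (-lam * |x|) : ℂ) - F x)
    (heq : ∫ x : ℝ, ‖(Real.exp (-lam * |x|) : ℂ) - F x‖ =
      2 / lam - 2 / lam * (1 / Real.cosh (lam / 2))) {x : ℝ}
    (hx : Real.cos (Real.pi * x) = 0) : (Real.exp (-lam * |x|) : ℂ) - F x = 0 := by
  set w : ℝ → ℂ := fun x => (Real.exp (-lam * |x|) : ℂ) - F x with hwdef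
  have hwc : Continuous w :=
    Continuous.sub (by fun_prop) (hF.1.continuous.comp Complex.continuous_ofReal)
  set s : ℝ → ℝ := fun x => Real.sign (Real.cos (Real.pi * x)) with hs
  have hsm : AEStronglyMeasurable fun x : ℝ => ((s x : ℝ) : ℂ) :=
    (Complex.measurable_ofReal.comp (Real.measurable_sign.comp (by fun_prop))).aestronglyMeasurable
  have hs1 : ∀ x, |s x| ≤ 1 := fun x => Real.abs_sign_le_one _
  have hws : Integrable fun x => w x * (s x : ℂ) :=
    hw.mul_of_norm_le hsm fun x => by rw [Complex.norm_real]; exact hs1 x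
  have hre : ∫ x, (w x).re * s x = 2 / lam - 2 / lam * (1 / Real.cosh (lam / 2)) := by
    have h1 := integral_error_mul_sign_cos hlam hF hw
    have h2 := integral_re hws
    rw [h1, RCLike.re_eq_complex_re, Complex.ofReal_re] at h2
    rw [← h2]
    refine integral_congr_ae (Eventually.of_forall fun x => ?_)
    simp
  have hrei : Integrable fun x => (w x).re * s x := by
    refine hws.re.congr (Eventually.of_forall fun x => ?_)
    simp
  have hle : ∀ x, (w x).re * s x ≤ ‖w x‖ := fun x => by
    refine (le_abs_self _).trans ?_
    rw [abs_mul]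
    exact (mul_le_of_le_one_right (abs_nonneg _) (hs1 x)).trans (Complex.abs_re_le_norm _)
  have hzero : ∫ x, (‖w x‖ - (w x).re * s x) = 0 := by
    rw [integral_sub hw.norm hrei, heq, hre, sub_self]
  have hae := (integral_eq_zero_iff_of_nonneg (fun x => sub_nonneg.2 (hle x))
    (hw.norm.sub hrei)).1 hzero
  have hae' : (fun x => ‖w x‖ * |Real.cos (Real.pi * x)|) =ᵐ[volume]
      fun x => (w x).re * Real.cos (Real.pi * x) := by
    filter_upwards [hae] with y hy
    have h1 : ‖w y‖ = (w y).re * s y := by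
      simpa [sub_eq_zero] using hy
    rw [h1, mul_assoc, hs, Real.sign_mul_abs_self]
  have hall := (Continuous.ae_eq_iff_eq volume (hwc.norm.mul (by fun_prop))
    ((Complex.continuous_re.comp hwc).mul (by fun_prop))).1 hae'
  exact eq_zero_of_aligned_with_cos hwc (congrFun hall) hx

lemma integrable_error_expInterp {lam : ℝ} (hlam : 0 < lam) :
    Integrable fun x : ℝ => (Real.exp (-lam * |x|) : ℂ) - expInterp lam x :=
  ((integrable_exp_neg_mul_abs hlam).ofReal (𝕜 := ℂ)).sub (integrable_expInterp hlam)

lemma integral_norm_error_expInterp {lam : ℝ} (hlam : 0 < lam) :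
    ∫ x : ℝ, ‖(Real.exp (-lam * |x|) : ℂ) - expInterp lam x‖ =
      2 / lam - 2 / lam * (1 / Real.cosh (lam / 2)) := by
  have h := integral_error_mul_sign_cos hlam (isEntireOfExpType_expInterp hlam)
    (integrable_error_expInterp hlam)
  have e : ∀ x : ℝ, ((Real.exp (-lam * |x|) : ℂ) - expInterp lam x) *
      (Real.sign (Real.cos (Real.pi * x)) : ℝ) =
      ((‖(Real.exp (-lam * |x|) : ℂ) - expInterp lam x‖ : ℝ) : ℂ) := by
    intro x
    rw [expInterp_ofReal hlam, ← Complex.ofReal_sub, sub_sub_cancel, ← Complex.ofReal_mul,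
      Complex.norm_real, Real.norm_eq_abs, abs_mul, abs_div, abs_of_pos Real.pi_pos,
      abs_of_pos (errorLaplace_pos hlam (abs_nonneg x))]
    congr 1
    have h1 : Real.cos (Real.pi * x) * Real.sign (Real.cos (Real.pi * x)) =
        |Real.cos (Real.pi * x)| := by
      rcases lt_trichotomy (Real.cos (Real.pi * x)) 0 with h | h | h
      · rw [Real.sign_of_neg h, abs_of_neg h]; ring
      · rw [h]; simp
      · rw [Real.sign_of_pos h, abs_of_pos h, mul_one]
    rw [← h1]
    ring
  simp_rw [e] at h
  rw [integral_complex_ofReal] at h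
  exact_mod_cast h

lemma extremal_error_nonneg {lam : ℝ} (hlam : 0 < lam) :
    0 ≤ 2 / lam - 2 / lam * (1 / Real.cosh (lam / 2)) := by
  rw [← integral_norm_error_expInterp hlam]
  exact integral_nonneg fun x => norm_nonneg _

/-- The extremal problem for exponential type `π`. -/
lemma lintegral_error_extremal {lam : ℝ} (hlam : 0 < lam) {F : ℂ → ℂ}
    (hF : IsEntireOfExpType Real.pi F) :
    ENNReal.ofReal (2 / lam - 2 / lam * (1 / Real.cosh (lam / 2))) ≤
        ∫⁻ x : ℝ, ‖(Real.exp (-lam * |x|) : ℂ) - F x‖ₑ ∧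
      (∫⁻ x : ℝ, ‖(Real.exp (-lam * |x|) : ℂ) - F x‖ₑ =
          ENNReal.ofReal (2 / lam - 2 / lam * (1 / Real.cosh (lam / 2))) ↔
        ∀ z : ℂ, F z = expInterp lam z) := by
  have hwc : Continuous fun x : ℝ => (Real.exp (-lam * |x|) : ℂ) - F x :=
    Continuous.sub (by fun_prop) (hF.1.continuous.comp Complex.continuous_ofReal)
  have hfin : ∫⁻ x : ℝ, ‖(Real.exp (-lam * |x|) : ℂ) - F x‖ₑ ≠ ⊤ →
      Integrable fun x : ℝ => (Real.exp (-lam * |x|) : ℂ) - F x :=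
    fun h => ⟨hwc.aestronglyMeasurable, lt_top_iff_ne_top.2 h⟩
  refine ⟨?_, fun h => ?_, fun h => ?_⟩
  · by_cases htop : ∫⁻ x : ℝ, ‖(Real.exp (-lam * |x|) : ℂ) - F x‖ₑ = ⊤
    · rw [htop]
      exact le_top
    have hw := hfin htop
    rw [← ofReal_integral_norm_eq_lintegral_enorm hw]
    refine ENNReal.ofReal_le_ofReal ?_
    have h1 := norm_integral_le_integral_norm (μ := volume) fun x : ℝ =>
      ((Real.exp (-lam * |x|) : ℂ) - F x) * (Real.sign (Real.cos (Real.pi * x)) : ℝ)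
    rw [integral_error_mul_sign_cos hlam hF hw, Complex.norm_real] at h1
    refine (le_abs_self _).trans (h1.trans ?_)
    refine integral_mono_of_nonneg (Eventually.of_forall fun x => norm_nonneg _) hw.norm
      (Eventually.of_forall fun x => ?_)
    simp only [norm_mul, Complex.norm_real]
    exact mul_le_of_le_one_right (norm_nonneg _) (Real.abs_sign_le_one _)
  · have hw := hfin (by rw [h]; exact ENNReal.ofReal_ne_top)
    rw [← ofReal_integral_norm_eq_lintegral_enorm hw,
      ENNReal.ofReal_eq_ofReal_iff (integral_nonneg fun x => norm_nonneg _)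
        (extremal_error_nonneg hlam)] at h
    intro z
    refine sub_eq_zero.1 (eq_zero_of_vanish_at_half_integers
      (hF.sub (isEntireOfExpType_expInterp hlam))
      ((integrable_of_integrable_error hlam hw).sub (integrable_expInterp hlam)) (fun n => ?_) z)
    have h1 := error_eq_zero_of_integral_norm_eq hlam hF hw h (x := (n : ℝ) - 1 / 2)
      ((cos_pi_mul_eq_zero_iff _).2 ⟨n, rfl⟩)
    have e : (((n : ℝ) - 1 / 2 : ℝ) : ℂ) = (n : ℂ) - 1 / 2 := by push_cast; ring
    rw [e, sub_eq_zero] at h1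
    rw [expInterp_int_sub_half, ← h1, sub_self]
  · simp_rw [h]
    rw [← ofReal_integral_norm_eq_lintegral_enorm (integrable_error_expInterp hlam),
      integral_norm_error_expInterp hlam]

theorem theorem1p1 (lam : ℝ) (hlam : 0 < lam) :
    -- `K(λ, ·)` is entire of exponential type `π`
    IsEntireOfExpType Real.pi (expInterp lam) ∧
    -- it interpolates `e^{-λ|x|}` at the integers plus a half
    (∀ n : ℤ, expInterp lam ((n : ℂ) - 1 / 2) = (Real.exp (-lam * |(n : ℝ) - 1 / 2|) : ℂ)) ∧
    -- lower bound for the `L¹` distance, and the case of equality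
    (∀ δ : ℝ, 0 < δ → ∀ F : ℂ → ℂ, IsEntireOfExpType (Real.pi * δ) F →
      ENNReal.ofReal (2 / lam - 2 / lam * (1 / Real.cosh (lam / (2 * δ)))) ≤
          ∫⁻ x : ℝ, ‖(Real.exp (-lam * |x|) : ℂ) - F (x : ℂ)‖ₑ ∧
      (∫⁻ x : ℝ, ‖(Real.exp (-lam * |x|) : ℂ) - F (x : ℂ)‖ₑ =
          ENNReal.ofReal (2 / lam - 2 / lam * (1 / Real.cosh (lam / (2 * δ)))) ↔
        ∀ z : ℂ, F z = expInterp (δ⁻¹ * lam) (δ * z))) ∧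
    -- `K(λ, x)` is real for real `x`, and the sign identity holds
    (∀ x : ℝ, (expInterp lam (x : ℂ)).im = 0 ∧
      Real.sign (Real.cos (Real.pi * x)) =
        Real.sign (Real.exp (-lam * |x|) - (expInterp lam (x : ℂ)).re)) := by
  refine ⟨isEntireOfExpType_expInterp hlam, expInterp_int_sub_half lam, fun δ hδ F hF => ?_,
    fun x => ⟨by rw [expInterp_ofReal hlam, Complex.ofReal_im], sign_cos_eq_sign_error hlam x⟩⟩
  -- the substitution `y = δ x` reduces to type `π` and the parameter `λ / δ`
  have hδ' : (δ : ℂ) ≠ 0 := Complex.ofReal_ne_zero.2 hδ.ne'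
  have hF' := hF.comp_inv_mul hδ
  obtain ⟨hle, heq⟩ := lintegral_error_extremal (mul_pos (inv_pos.2 hδ) hlam) hF'
  have hmeas : Measurable fun y : ℝ => ‖(Real.exp (-(δ⁻¹ * lam) * |y|) : ℂ) -
      F (((δ⁻¹ : ℝ) : ℂ) * y)‖ₑ :=
    (Continuous.sub (by fun_prop)
      (hF'.1.continuous.comp Complex.continuous_ofReal)).enorm.measurable
  have hscale : ∫⁻ x : ℝ, ‖(Real.exp (-lam * |x|) : ℂ) - F (x : ℂ)‖ₑ =
      ENNReal.ofReal δ⁻¹ * ∫⁻ y : ℝ, ‖(Real.exp (-(δ⁻¹ * lam) * |y|) : ℂ) -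
        F (((δ⁻¹ : ℝ) : ℂ) * y)‖ₑ := by
    have hmap := Real.map_volume_mul_left hδ.ne'
    rw [abs_of_pos (inv_pos.2 hδ)] at hmap
    rw [← smul_eq_mul, ← lintegral_smul_measure, ← hmap,
      lintegral_map hmeas (measurable_const_mul δ)]
    refine lintegral_congr fun x => ?_
    have e1 : -(δ⁻¹ * lam) * |δ * x| = -lam * |x| := by
      rw [abs_mul, abs_of_pos hδ]
      field_simp
    have e2 : ((δ⁻¹ : ℝ) : ℂ) * ((δ * x : ℝ) : ℂ) = x := by
      push_cast
      field_simp
    rw [e1, e2]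
  have hval : 2 / lam - 2 / lam * (1 / Real.cosh (lam / (2 * δ))) =
      δ⁻¹ * (2 / (δ⁻¹ * lam) - 2 / (δ⁻¹ * lam) * (1 / Real.cosh (δ⁻¹ * lam / 2))) := by
    have e : δ⁻¹ * lam / 2 = lam / (2 * δ) := by field_simp
    have hc := Real.cosh_pos (lam / (2 * δ))
    rw [e]
    field_simp
  have h0 : ENNReal.ofReal δ⁻¹ ≠ 0 := (ENNReal.ofReal_pos.2 (inv_pos.2 hδ)).ne'
  rw [hscale, hval, ENNReal.ofReal_mul (inv_pos.2 hδ).le]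
  refine ⟨mul_le_mul_right hle _, ?_⟩
  rw [ENNReal.mul_right_inj h0 ENNReal.ofReal_ne_top, heq]
  constructor
  · intro h z
    have h1 := h (δ * z)
    rwa [Complex.ofReal_inv, inv_mul_cancel_left₀ hδ'] at h1
  · intro h z
    rw [h, Complex.ofReal_inv, mul_inv_cancel_left₀ hδ']
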